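/- Notation. For $d\in\mathbb N$ let $\mathcal S_d$ be the space of symmetric real $d\times d$ matrices and $\mathcal S_d^+$ the closed cone of positive semidefinite ones; $\|\cdot\|_2$ is the Euclidean norm, $\|A\|_F=\sqrt{\operatorname{tr}(A^\top A)}$, $\sqrt Q$ is the positive semidefinite square root of $Q\in\mathcal S_d^+$, and $\mathcal N(0,Q)$ is the centred Gaussian law on $\mathbb R^d$ with covariance matrix $Q$. Let $L$ and $D_1,\dots,D_{L+1}$ be fixed natural numbers. For $\ell=1,\dots,L$ let $\mathcal G^{(\ell)}:\mathbb R^{D_\ell}\to\mathcal S^+_{D_{\ell+1}}$ be continuous and such that for every $\varepsilon>0$ there is $C_\varepsilon>0$ with $$\|\mathcal G^{(\ell)}(z)-\mathcal G^{(\ell)}(z')\|_F\le C_\varepsilon\bigl[1+\|z-z'\|_2(\|z\|_2+\|z'\|_2)\bigr]+\varepsilon\bigl(\|z\|_2^2+\|z'\|_2^2\bigr)\qquad\text{for all } z,z'\in\mathbb R^{D_\ell}.$$ Let $C_\ell(n)\in\mathbb N$ ($\ell=1,\dots,L$, $n\ge1$) satisfy $C_\ell(n)/n\to\alpha_\ell\in(0,\infty)$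 as $n\to\infty$. Fix a deterministic matrix $\mathbf K^{(1)}\in\mathcal S^+_{D_1}$. For each $n\ge 1$ let $\mathbf K^{(1,n)},\dots,\mathbf K^{(L+1,n)}$ be a Markov sequence of random matrices with values in $\mathcal S^+_{D_1}\times\dots\times\mathcal S^+_{D_{L+1}}$, defined on a common probability space, with $\mathbf K^{(1,n)}=\mathbf K^{(1)}$ almost surely and transition kernels $$\nu_{\ell+1,n}(B\mid Q)=\mathbb P\Bigl\{\frac1{C_\ell(n)}\sum_{c=1}^{C_\ell(n)}\mathcal G^{(\ell)}\bigl(\sqrt Q\,Z^{(\ell)}_c\bigr)\in B\Bigr\},\qquad Z^{(\ell)}_c\overset{iid}{\sim}\mathcal N(0,\mathbf 1_{D_\ell}),$$ that is, the conditional law of $\mathbf K^{(\ell+1,n)}$ given $\mathbf K^{(1,n)},\dots,\mathbf K^{(\ell,n)}$ is $\nu_{\ell+1,n}(\cdot\mid\mathbf K^{(\ell,n)})$ for $\ell=1,\dots,L$. For $Q_1\in\mathcal S^+_{D_\ell}$ and $Q_2\in\mathcal S^+_{D_{\ell+1}}$ put $$I_\ell(Q_2\mid Q_1)=\sup_{Q_0\in\mathcal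 S_{D_{\ell+1}}}\Bigl\{\operatorname{tr}(Q_0^\top Q_2)-\log\int_{\mathbb R^{D_\ell}}e^{\operatorname{tr}(Q_0^\top\mathcal G^{(\ell)}(z))}\,\mathcal N(dz\mid 0,Q_1)\Bigr\}\in[0,+\infty],$$ with $\log(+\infty)=+\infty$. **Proposition (LDP for the general structure).** The sequence $\{(\mathbf K^{(2,n)},\dots,\mathbf K^{(L+1,n)})\}_{n\ge1}$ satisfies a large deviation principle on $\mathcal S^+_{D_2}\times\dots\times\mathcal S^+_{D_{L+1}}$ with speed $n$ and rate function $$I(Q_2,\dots,Q_{L+1})=\alpha_1 I_1\bigl(Q_2\mid\mathbf K^{(1)}\bigr)+\sum_{\ell=2}^L\alpha_\ell\, I_\ell(Q_{\ell+1}\mid Q_\ell),$$ and this rate function is good. Explicitly, $I$ takes values in $\mathbb R\cup\{+\infty\}$, is lower semicontinuous and has compact sublevel sets, and the laws $\mu_n$ of $(\mathbf K^{(2,n)},\dots,\mathbf K^{(L+1,n)})$ satisfy $$\liminf_{n\to\infty}\tfrac1n\log\mu_n(O)\ge-\inf_{O}I\ \text{ for every open } O,\qquad \limsup_{n\to\infty}\tfrac1n\log\mu_n(F)\le-\inf_{F}I\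 \text{ for every closed } F.$$ -/

import Mathlib

open MeasureTheory ProbabilityTheory Filter Topology
open scoped ENNReal

noncomputable section

namespace CovLDP

/-- The vector space `ℝ^d` with its Euclidean norm. -/
abbrev Vec (d : ℕ) : Type := EuclideanSpace ℝ (Fin d)

/-- The cone `𝒮⁺_d` of symmetric positive semidefinite real `d × d` matrices, with the topology
induced from the space of matrices. -/
abbrev PSD (d : ℕ) : Type := {Q : Matrix (Fin d) (Fin d) ℝ // Q.PosSemidef}

instance instMeasurableSpacePSD (d : ℕ) : MeasurableSpace (PSD d) := borel (PSD d)

instance instBorelSpacePSD (d : ℕ) : BorelSpace (PSD d) := ⟨rfl⟩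

instance instSecondCountablePSD (d : ℕ) : SecondCountableTopology (PSD d) := by
  have : SecondCountableTopology (Matrix (Fin d) (Fin d) ℝ) :=
    inferInstanceAs (SecondCountableTopology (Fin d → Fin d → ℝ))
  exact TopologicalSpace.Subtype.secondCountableTopology _

/-- The Frobenius norm `‖A‖_F = √(tr(Aᵀ A))`. -/
def frobNorm {d : ℕ} (A : Matrix (Fin d) (Fin d) ℝ) : ℝ :=
  Real.sqrt (A.transpose * A).trace

/-- The empirical mean `(1/C) ∑_c A_c` of positive semidefinite matrices. -/
def empMean {d C : ℕ} (A : Fin C → PSD d) : PSD d :=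
  ⟨(C : ℝ)⁻¹ • ∑ c, (A c).1,
    (Matrix.posSemidef_sum Finset.univ fun c _ => (A c).2).smul (by positivity)⟩

section

open scoped MatrixOrder

/-- `√Q z`, where `√Q` is the positive semidefinite square root of `Q`. -/
def sqrtMul {d : ℕ} (Q : PSD d) (z : Vec d) : Vec d :=
  Matrix.toEuclideanCLM (𝕜 := ℝ) (CFC.sqrt Q.1) z

end

/-- The transition kernel `ν(· | Q)`: the law of `(1/C) ∑_{c=1}^C g(√Q Z_c)` where
`Z_1, …, Z_C` are i.i.d. standard Gaussian vectors of `ℝ^d`. -/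
def transition {d d' : ℕ} (g : Vec d → PSD d') (C : ℕ) (Q : PSD d) : Measure (PSD d') :=
  (Measure.pi fun _ : Fin C => stdGaussian (Vec d)).map
    fun Z => empMean fun c => g (sqrtMul Q (Z c))

/-- `g` is continuous and for every `ε > 0` there is `C_ε > 0` such that
`‖g z - g z'‖_F ≤ C_ε (1 + ‖z - z'‖ (‖z‖ + ‖z'‖)) + ε (‖z‖² + ‖z'‖²)` for all `z, z'`. -/
def QuadraticIncrement {d d' : ℕ} (g : Vec d → PSD d') : Prop :=
  Continuous g ∧
    ∀ ε : ℝ, 0 < ε → ∃ Cε : ℝ, 0 < Cε ∧ ∀ z z' : Vec d,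
      frobNorm ((g z).1 - (g z').1) ≤
        Cε * (1 + ‖z - z'‖ * (‖z‖ + ‖z'‖)) + ε * (‖z‖ ^ 2 + ‖z'‖ ^ 2)

/-- `M(Q₀ | Q₁) = ∫ exp(tr(Q₀ᵀ g(z))) 𝒩(dz | 0, Q₁)`, an element of `[0, ∞]`. -/
def expMoment {d d' : ℕ} (g : Vec d → PSD d') (Q₁ : PSD d)
    (Q₀ : Matrix (Fin d') (Fin d') ℝ) : ℝ≥0∞ :=
  ∫⁻ z, ENNReal.ofReal (Real.exp (Q₀.transpose * (g z).1).trace) ∂(multivariateGaussian 0 Q₁.1)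

/-- The conditional Cramér rate `I(Q₂ | Q₁) = sup_{Q₀ symmetric} {tr(Q₀ᵀ Q₂) - log M(Q₀ | Q₁)}`,
with `log ∞ = ∞`. -/
def condRate {d d' : ℕ} (g : Vec d → PSD d') (Q₁ : PSD d) (Q₂ : PSD d') : EReal :=
  ⨆ Q₀ : {A : Matrix (Fin d') (Fin d') ℝ // A.IsSymm},
    (((Q₀.1.transpose * Q₂.1).trace : ℝ) : EReal) - ENNReal.log (expMoment g Q₁ Q₀.1)

/-- Given maps `G ℓ` for `ℓ = 0, …, L-1` (the transition from component `ℓ` to component `ℓ+1`)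
and the numbers of samples `C ℓ`, `X_0, …, X_L` is a Markov sequence of random positive
semidefinite matrices, started at the deterministic matrix `Q₀`, with transition kernels
`transition (G ℓ) (C ℓ)`: the conditional law of `X_{ℓ+1}` given `X_0, …, X_ℓ` is
`transition (G ℓ) (C ℓ) X_ℓ`. -/
structure IsCovChain {Ω : Type*} [MeasurableSpace Ω] (P : Measure Ω) {L : ℕ} {D : Fin (L + 1) → ℕ}
    (G : (ℓ : Fin L) → Vec (D ℓ.castSucc) → PSD (D ℓ.succ)) (C : Fin L → ℕ) (Q₀ : PSD (D 0))
    (X : (i : Fin (L + 1)) → Ω → PSD (D i)) : Prop where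
  measurable : ∀ i, Measurable (X i)
  init : ∀ᵐ ω ∂P, X 0 ω = Q₀
  markov : ∀ (ℓ : Fin L) (B : Set (PSD (D ℓ.succ))), MeasurableSet B →
    P[(X ℓ.succ ⁻¹' B).indicator (fun _ => (1 : ℝ)) |
        ⨆ i : {i : Fin (L + 1) // i ≤ ℓ.castSucc}, MeasurableSpace.comap (X i.1) inferInstance]
      =ᵐ[P] fun ω => (transition (G ℓ) (C ℓ) (X ℓ.castSucc ω)).real B

/-- `I : 𝕏 → ℝ ∪ {+∞}` is a good rate function: it is lower semicontinuous and has compact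
sublevel sets. -/
structure IsGoodRateFunction {𝕏 : Type*} [TopologicalSpace 𝕏] (I : 𝕏 → EReal) : Prop where
  ne_bot : ∀ x, I x ≠ ⊥
  lsc : LowerSemicontinuous I
  compact_sublevel : ∀ a : ℝ, IsCompact {x | I x ≤ (a : EReal)}

/-- The sequence of Borel measures `μ n` satisfies the large deviation lower and upper bounds
with speed `n` and rate `I`. -/
structure SatisfiesLDP {𝕏 : Type*} [TopologicalSpace 𝕏] [MeasurableSpace 𝕏]
    (μ : ℕ → Measure 𝕏) (I : 𝕏 → EReal) : Prop where
  lower : ∀ O : Set 𝕏, IsOpen O →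
    -(⨅ x ∈ O, I x) ≤ liminf (fun n : ℕ => ENNReal.log (μ n O) / (n : EReal)) atTop
  upper : ∀ F : Set 𝕏, IsClosed F →
    limsup (fun n : ℕ => ENNReal.log (μ n F) / (n : EReal)) atTop ≤ -(⨅ x ∈ F, I x)

/-- The rate function
`(Q_1, …, Q_L) ↦ ∑_{ℓ=0}^{L-1} α_ℓ I_ℓ(Q_{ℓ+1} | Q_ℓ)`, where `Q_0` is the deterministic
initial matrix of the chain. -/
def chainRate {L : ℕ} {D : Fin (L + 1) → ℕ}
    (G : (ℓ : Fin L) → Vec (D ℓ.castSucc) → PSD (D ℓ.succ)) (α : Fin L → ℝ) (Q₀ : PSD (D 0))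
    (Q : (ℓ : Fin L) → PSD (D ℓ.succ)) : EReal :=
  ∑ ℓ : Fin L, (α ℓ : EReal) *
    condRate (G ℓ) (Fin.cons (α := fun i => PSD (D i)) Q₀ Q ℓ.castSucc) (Q ℓ)

end CovLDP

end

/-!
Given `K^(ℓ)`, the next matrix is a mean of independent copies of `G (√(K^(ℓ)) Z)`, so each layer is
a Cramér theorem in a finite-dimensional space, with a parameter `Q = K^(ℓ)`. Only small
exponential moments of `G (√Q Z)` are finite, so the lower bound is proved without moment
assumptions: truncate, penalise the cumulant generating function by `δ‖θ‖²` so that the optimal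
tilt exists, and apply the law of large numbers under the tilted law. The increment condition says
that `Q ↦ G (√Q ·)` is continuous in the sup norm weighted by `1 + ‖z‖²`, a function with an
exponential moment under the Gaussian law. So the probability that a small change of `Q` moves the
mean noticeably decays at any prescribed exponential rate, and all bounds hold locally uniformly in
`Q`. Such bounds multiply along a Markov chain, hence the rates of the layers add up.
-/

noncomputable section

namespace CovLDP

/-- The exponential as a map into `[0, ∞]`, in which all the exponential bounds are stated. -/
def eexp (t : ℝ) : ℝ≥0∞ :=
  ENNReal.ofReal (Real.exp t)

section ExtendedExponential

variable {s t : ℝ}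

@[simp]
lemma eexp_zero : eexp 0 = 1 := by simp [eexp]

lemma eexp_pos (t : ℝ) : 0 < eexp t :=
  ENNReal.ofReal_pos.2 (Real.exp_pos t)

@[simp]
lemma eexp_ne_top (t : ℝ) : eexp t ≠ ∞ :=
  ENNReal.ofReal_ne_top

lemma eexp_add (s t : ℝ) : eexp (s + t) = eexp s * eexp t := by
  rw [eexp, Real.exp_add, ENNReal.ofReal_mul (Real.exp_pos s).le, eexp, eexp]

lemma eexp_sum {ι : Type*} (S : Finset ι) (f : ι → ℝ) :
    eexp (∑ i ∈ S, f i) = ∏ i ∈ S, eexp (f i) := by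
  simp only [eexp, Real.exp_sum, ENNReal.ofReal_prod_of_nonneg fun _ _ => (Real.exp_pos _).le]

lemma eexp_natCast_mul (n : ℕ) (t : ℝ) : eexp (n * t) = eexp t ^ n := by
  rw [eexp, Real.exp_nat_mul, ENNReal.ofReal_pow (Real.exp_pos t).le, eexp]

lemma eexp_mul (s t : ℝ) : eexp (s * t) = eexp s ^ t := by
  rw [eexp, Real.exp_mul, ← ENNReal.ofReal_rpow_of_pos (Real.exp_pos s), eexp]

@[simp]
lemma eexp_le_eexp : eexp s ≤ eexp t ↔ s ≤ t := by
  rw [eexp, eexp, ENNReal.ofReal_le_ofReal_iff (Real.exp_pos t).le, Real.exp_le_exp]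

@[simp]
lemma eexp_lt_eexp : eexp s < eexp t ↔ s < t :=
  lt_iff_lt_of_le_iff_le eexp_le_eexp

@[gcongr]
lemma eexp_mono (h : s ≤ t) : eexp s ≤ eexp t :=
  eexp_le_eexp.2 h

@[simp]
lemma log_eexp (t : ℝ) : ENNReal.log (eexp t) = t := by
  rw [eexp, ENNReal.log_ofReal_of_pos (Real.exp_pos t), Real.log_exp]

@[fun_prop]
lemma continuous_eexp : Continuous eexp :=
  ENNReal.continuous_ofReal.comp Real.continuous_exp

lemma exists_le_eexp {m : ℝ≥0∞} (hm : m ≠ ∞) : ∃ t : ℝ, m ≤ eexp t := by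
  refine ⟨m.toReal, ?_⟩
  rw [eexp, ENNReal.le_ofReal_iff_toReal_le hm (Real.exp_pos _).le]
  exact (lt_add_one _).le.trans (Real.add_one_le_exp _)

lemma tendsto_eexp_natCast_mul {t : ℝ} (ht : 0 < t) :
    Tendsto (fun n : ℕ => eexp (n * t)) atTop (𝓝 ∞) :=
  ENNReal.tendsto_ofReal_atTop.comp
    (Real.tendsto_exp_atTop.comp (tendsto_natCast_atTop_atTop.atTop_mul_const ht))

lemma eventually_mul_eexp_neg_le {m : ℝ≥0∞} (hm : m ≠ ∞) (h : s < t) :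
    ∀ᶠ n : ℕ in atTop, m * eexp (-(n * t)) ≤ eexp (-(n * s)) := by
  filter_upwards [(tendsto_eexp_natCast_mul (sub_pos.2 h)).eventually_const_le
    (lt_top_iff_ne_top.2 hm)] with n hn
  calc m * eexp (-(n * t)) ≤ eexp (n * (t - s)) * eexp (-(n * t)) := by gcongr
    _ = eexp (-(n * s)) := by rw [← eexp_add]; ring_nf

lemma log_div_natCast_le {m : ℝ≥0∞} {n : ℕ} (hn : 0 < n) (h : m ≤ eexp (-(n * t))) :
    ENNReal.log m / (n : EReal) ≤ ((-t : ℝ) : EReal) := by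
  rw [EReal.div_le_iff_le_mul (by exact_mod_cast hn) (EReal.natCast_ne_top n)]
  refine (ENNReal.log_monotone h).trans_eq ?_
  rw [log_eexp, show (n : EReal) = ((n : ℝ) : EReal) from rfl, ← EReal.coe_mul]
  congr 1
  ring

lemma le_log_div_natCast {m : ℝ≥0∞} {n : ℕ} (hn : 0 < n) (h : eexp (-(n * t)) ≤ m) :
    ((-t : ℝ) : EReal) ≤ ENNReal.log m / (n : EReal) := by
  rw [EReal.le_div_iff_mul_le (by exact_mod_cast hn) (EReal.natCast_ne_top n)]
  refine Eq.trans_le ?_ (ENNReal.log_monotone h)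
  rw [log_eexp, show (n : EReal) = ((n : ℝ) : EReal) from rfl, ← EReal.coe_mul]
  congr 1
  ring

end ExtendedExponential

section LocalLargeDeviations

variable {𝕏 𝕐 : Type*} [TopologicalSpace 𝕏] [MeasurableSpace 𝕏] [TopologicalSpace 𝕐]
  [MeasurableSpace 𝕐]

/-- Large deviation bounds with speed `n` and rate `I` in their local form: exponential bounds for
neighbourhoods of points, together with exponential tightness. Unlike the bounds for open and closed
sets, these are inherited by closed embeddings and combine along a Markov chain. -/
structure SatisfiesLocalLDP (μ : ℕ → Measure 𝕏) (I : 𝕏 → EReal) : Prop where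
  ne_bot : ∀ x, I x ≠ ⊥
  lower : ∀ (x : 𝕏) (a : ℝ), I x < a → ∀ U ∈ 𝓝 x, ∀ᶠ n : ℕ in atTop, eexp (-(n * a)) ≤ μ n U
  upper : ∀ (x : 𝕏) (a : ℝ), a < I x → ∃ U ∈ 𝓝 x, ∀ᶠ n : ℕ in atTop, μ n U ≤ eexp (-(n * a))
  tight : ∀ a : ℝ, ∃ K : Set 𝕏, IsCompact K ∧ ∀ᶠ n : ℕ in atTop, μ n Kᶜ ≤ eexp (-(n * a))

namespace SatisfiesLocalLDP

variable {μ : ℕ → Measure 𝕏} {I : 𝕏 → EReal}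

lemma congr {ν : ℕ → Measure 𝕏} (h : SatisfiesLocalLDP μ I) (hμν : ∀ᶠ n in atTop, μ n = ν n) :
    SatisfiesLocalLDP ν I where
  ne_bot := h.ne_bot
  lower x a ha U hU := by
    filter_upwards [hμν, h.lower x a ha U hU] with n hn hle
    rwa [← hn]
  upper x a ha := by
    obtain ⟨U, hU, hle⟩ := h.upper x a ha
    refine ⟨U, hU, ?_⟩
    filter_upwards [hμν, hle] with n hn hle
    rwa [← hn]
  tight a := by
    obtain ⟨K, hK, hle⟩ := h.tight a
    refine ⟨K, hK, ?_⟩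
    filter_upwards [hμν, hle] with n hn hle
    rwa [← hn]

lemma coe_le_of_eventually_le (h : SatisfiesLocalLDP μ I) {x : 𝕏} {U : Set 𝕏} (hU : U ∈ 𝓝 x)
    {a : ℝ} (hle : ∀ᶠ n : ℕ in atTop, μ n U ≤ eexp (-(n * a))) : a ≤ I x := by
  by_contra! hlt
  obtain ⟨b, hb, hba⟩ := EReal.lt_iff_exists_real_btwn.1 hlt
  obtain ⟨n, hn, hle, hge⟩ :=
    ((eventually_gt_atTop 0).and (hle.and (h.lower x b hb U hU))).exists
  have hn' : (0 : ℝ) < n := by exact_mod_cast hn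
  have hmul : (n : ℝ) * a ≤ n * b := neg_le_neg_iff.1 (eexp_le_eexp.1 (hge.trans hle))
  exact (le_of_mul_le_mul_left hmul hn').not_gt (by exact_mod_cast hba)

lemma lowerSemicontinuous (h : SatisfiesLocalLDP μ I) : LowerSemicontinuous I := by
  intro x b hb
  obtain ⟨a, hba, hax⟩ := EReal.lt_iff_exists_real_btwn.1 hb
  obtain ⟨U, hU, hle⟩ := h.upper x a hax
  filter_upwards [eventually_mem_nhds_iff.2 hU] with z hz
  exact hba.trans_le (h.coe_le_of_eventually_le hz hle)

theorem isGoodRateFunction [T2Space 𝕏] (h : SatisfiesLocalLDP μ I) : IsGoodRateFunction I where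
  ne_bot := h.ne_bot
  lsc := h.lowerSemicontinuous
  compact_sublevel a := by
    obtain ⟨K, hK, hle⟩ := h.tight (a + 1)
    refine hK.of_isClosed_subset (h.lowerSemicontinuous.isClosed_preimage a) fun x hx => ?_
    by_contra hxK
    have hge := h.coe_le_of_eventually_le (hK.isClosed.isOpen_compl.mem_nhds hxK) hle
    exact (lt_add_one a).not_ge (by exact_mod_cast hge.trans hx)

lemma neg_iInf_le_liminf (h : SatisfiesLocalLDP μ I) {O : Set 𝕏} (hO : IsOpen O) :
    -(⨅ x ∈ O, I x) ≤ liminf (fun n : ℕ => ENNReal.log (μ n O) / (n : EReal)) atTop := by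
  rw [EReal.neg_le]
  refine le_iInf₂ fun x hx => le_of_forall_gt_imp_ge_of_dense fun b hb => ?_
  obtain ⟨a, hxa, hab⟩ := EReal.lt_iff_exists_real_btwn.1 hb
  refine le_trans ?_ hab.le
  rw [EReal.neg_le, ← EReal.coe_neg]
  refine le_liminf_of_le (by isBoundedDefault) ?_
  filter_upwards [eventually_gt_atTop 0, h.lower x a hxa O (hO.mem_nhds hx)] with n hn hle
  exact le_log_div_natCast hn hle

lemma eventually_measure_isClosed_le (h : SatisfiesLocalLDP μ I) {F : Set 𝕏} (hF : IsClosed F)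
    {a b : ℝ} (hab : a < b) (hb : ∀ x ∈ F, b < I x) :
    ∀ᶠ n : ℕ in atTop, μ n F ≤ eexp (-(n * a)) := by
  obtain ⟨K, hK, hμK⟩ := h.tight b
  choose! U hU hμU using fun x (hx : x ∈ K ∩ F) => h.upper x b (hb x hx.2)
  obtain ⟨t, htK, ht⟩ := (hK.inter_right hF).elim_nhds_subcover U hU
  have hcover : F ⊆ Kᶜ ∪ ⋃ x ∈ t, U x := fun x hxF =>
    or_iff_not_imp_left.2 fun hxK => ht ⟨not_not.1 hxK, hxF⟩
  have hμt : ∀ᶠ n : ℕ in atTop, ∀ x ∈ t, μ n (U x) ≤ eexp (-(n * b)) :=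
    (Finset.eventually_all t).2 fun x hx => hμU x (htK x hx)
  filter_upwards [hμt, hμK, eventually_mul_eexp_neg_le (m := 1 + t.card) (by finiteness) hab]
    with n hUle hKle hmul
  calc μ n F ≤ μ n Kᶜ + ∑ x ∈ t, μ n (U x) :=
        (measure_mono hcover).trans ((measure_union_le _ _).trans
          (add_le_add le_rfl (measure_biUnion_finset_le _ _)))
    _ ≤ eexp (-(n * b)) + ∑ _x ∈ t, eexp (-(n * b)) :=
        add_le_add hKle (Finset.sum_le_sum hUle)
    _ = (1 + t.card) * eexp (-(n * b)) := by
        rw [Finset.sum_const, nsmul_eq_mul, add_mul, one_mul]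
    _ ≤ eexp (-(n * a)) := hmul

theorem satisfiesLDP (h : SatisfiesLocalLDP μ I) : SatisfiesLDP μ I where
  lower _ hO := h.neg_iInf_le_liminf hO
  upper F hF := by
    rw [EReal.le_neg]
    refine le_of_forall_lt_imp_le_of_dense fun c hc => ?_
    obtain ⟨a, hca, ha⟩ := EReal.lt_iff_exists_real_btwn.1 hc
    obtain ⟨b, hab, hb⟩ := EReal.lt_iff_exists_real_btwn.1 ha
    refine hca.le.trans ?_
    rw [EReal.le_neg, ← EReal.coe_neg]
    refine limsup_le_of_le (by isBoundedDefault) ?_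
    filter_upwards [eventually_gt_atTop 0, h.eventually_measure_isClosed_le hF
      (EReal.coe_lt_coe_iff.1 hab) fun x hx => hb.trans_le (iInf₂_le x hx)] with n hn hle
    exact log_div_natCast_le hn hle

end SatisfiesLocalLDP

open scoped Classical in
theorem satisfiesLocalLDP_dirac [T1Space 𝕏] [OpensMeasurableSpace 𝕏] (x₀ : 𝕏) :
    SatisfiesLocalLDP (fun _ => Measure.dirac x₀) fun x => if x = x₀ then 0 else ⊤ where
  ne_bot x := by split_ifs <;> simp
  lower x a ha U hU := by
    have hx : x = x₀ := by
      by_contra hx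
      simp [hx] at ha
    subst hx
    have ha' : 0 < a := by simpa using ha
    refine Eventually.of_forall fun n => ?_
    rw [Measure.dirac_apply_of_mem (mem_of_mem_nhds hU), ← eexp_zero]
    gcongr
    nlinarith [n.cast_nonneg (α := ℝ)]
  upper x a ha := by
    rcases eq_or_ne x x₀ with rfl | hx
    · have ha' : a < 0 := by simpa using ha
      refine ⟨Set.univ, univ_mem, Eventually.of_forall fun n => ?_⟩
      rw [measure_univ, ← eexp_zero]
      gcongr
      nlinarith [n.cast_nonneg (α := ℝ)]
    · refine ⟨{x₀}ᶜ, isOpen_compl_singleton.mem_nhds hx, Eventually.of_forall fun n => ?_⟩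
      simp [Measure.dirac_apply' x₀ isOpen_compl_singleton.measurableSet]
  tight a := by
    refine ⟨{x₀}, isCompact_singleton, Eventually.of_forall fun n => ?_⟩
    simp [Measure.dirac_apply' x₀ isOpen_compl_singleton.measurableSet]

end LocalLargeDeviations

section LocallyUniform

variable {𝕎 𝕏 𝕐 𝕊 : Type*} [TopologicalSpace 𝕎] [TopologicalSpace 𝕏] [TopologicalSpace 𝕐]
  [MeasurableSpace 𝕐]

/-- Large deviation bounds for a sequence of transition kernels `κ n` from `𝕏` to `𝕐`, in the local
form of `SatisfiesLocalLDP` and locally uniformly in the starting point, with rate `J x` from the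
starting point `x`. -/
structure SatisfiesLocallyUniformLDP (κ : ℕ → 𝕏 → Measure 𝕐) (J : 𝕏 → 𝕐 → EReal) : Prop where
  ne_bot : ∀ x y, J x y ≠ ⊥
  lower : ∀ x y (a : ℝ), J x y < a → ∀ V ∈ 𝓝 y,
    ∃ U ∈ 𝓝 x, ∀ᶠ n : ℕ in atTop, ∀ x' ∈ U, eexp (-(n * a)) ≤ κ n x' V
  upper : ∀ x y (a : ℝ), a < J x y →
    ∃ U ∈ 𝓝 x, ∃ V ∈ 𝓝 y, ∀ᶠ n : ℕ in atTop, ∀ x' ∈ U, κ n x' V ≤ eexp (-(n * a))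
  tight : ∀ K : Set 𝕏, IsCompact K → ∀ a : ℝ,
    ∃ K' : Set 𝕐, IsCompact K' ∧ ∀ᶠ n : ℕ in atTop, ∀ x ∈ K, κ n x K'ᶜ ≤ eexp (-(n * a))

namespace SatisfiesLocallyUniformLDP

variable {κ : ℕ → 𝕏 → Measure 𝕐} {J : 𝕏 → 𝕐 → EReal}

lemma apply (h : SatisfiesLocallyUniformLDP κ J) (x : 𝕏) :
    SatisfiesLocalLDP (fun n => κ n x) (J x) where
  ne_bot := h.ne_bot x
  lower y a ha V hV := by
    obtain ⟨U, hU, hle⟩ := h.lower x y a ha V hV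
    exact hle.mono fun n hn => hn x (mem_of_mem_nhds hU)
  upper y a ha := by
    obtain ⟨U, hU, V, hV, hle⟩ := h.upper x y a ha
    exact ⟨V, hV, hle.mono fun n hn => hn x (mem_of_mem_nhds hU)⟩
  tight a := by
    obtain ⟨K, hK, hle⟩ := h.tight {x} isCompact_singleton a
    exact ⟨K, hK, hle.mono fun n hn => hn x rfl⟩

lemma comp_continuous (h : SatisfiesLocallyUniformLDP κ J) {φ : 𝕎 → 𝕏} (hφ : Continuous φ) :
    SatisfiesLocallyUniformLDP (fun n w => κ n (φ w)) fun w => J (φ w) where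
  ne_bot w := h.ne_bot (φ w)
  lower w y a ha V hV := by
    obtain ⟨U, hU, hle⟩ := h.lower (φ w) y a ha V hV
    exact ⟨φ ⁻¹' U, hφ.continuousAt hU, hle.mono fun n hn w' hw' => hn (φ w') hw'⟩
  upper w y a ha := by
    obtain ⟨U, hU, V, hV, hle⟩ := h.upper (φ w) y a ha
    exact ⟨φ ⁻¹' U, hφ.continuousAt hU, V, hV, hle.mono fun n hn w' hw' => hn (φ w') hw'⟩
  tight K hK a := by
    obtain ⟨K', hK', hle⟩ := h.tight (φ '' K) (hK.image hφ) a
    exact ⟨K', hK', hle.mono fun n hn w hw => hn (φ w) (Set.mem_image_of_mem φ hw)⟩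

lemma of_map_isClosedEmbedding [BorelSpace 𝕐] [TopologicalSpace 𝕊] [MeasurableSpace 𝕊]
    [OpensMeasurableSpace 𝕊] {κ : ℕ → 𝕏 → Measure 𝕊} {f : 𝕊 → 𝕐} (hf : IsClosedEmbedding f)
    (h : SatisfiesLocallyUniformLDP (fun n x => (κ n x).map f) J) :
    SatisfiesLocallyUniformLDP κ fun x z => J x (f z) where
  ne_bot x z := h.ne_bot x (f z)
  lower x z a ha V hV := by
    obtain ⟨V', hV', hVV'⟩ := (hf.isInducing.nhds_eq_comap z ▸ hV : V ∈ comap f (𝓝 (f z)))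
    obtain ⟨U, hU, hle⟩ := h.lower x (f z) a ha _ (interior_mem_nhds.2 hV')
    refine ⟨U, hU, hle.mono fun n hn x' hx' => (hn x' hx').trans ?_⟩
    rw [Measure.map_apply hf.continuous.measurable isOpen_interior.measurableSet]
    exact measure_mono ((Set.preimage_mono interior_subset).trans hVV')
  upper x z a ha := by
    obtain ⟨U, hU, V, hV, hle⟩ := h.upper x (f z) a ha
    exact ⟨U, hU, f ⁻¹' V, hf.continuous.continuousAt hV, hle.mono fun n hn x' hx' =>
      (Measure.le_map_apply hf.continuous.aemeasurable V).trans (hn x' hx')⟩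
  tight K hK a := by
    obtain ⟨K', hK', hle⟩ := h.tight K hK a
    exact ⟨f ⁻¹' K', hf.isCompact_preimage hK', hle.mono fun n hn x hx =>
      (Measure.le_map_apply hf.continuous.aemeasurable K'ᶜ).trans (hn x hx)⟩

end SatisfiesLocallyUniformLDP

lemma SatisfiesLocalLDP.const {μ : ℕ → Measure 𝕐} {I : 𝕐 → EReal} (h : SatisfiesLocalLDP μ I) :
    SatisfiesLocallyUniformLDP (fun n (_ : 𝕏) => μ n) fun _ => I where
  ne_bot _ := h.ne_bot
  lower _ y a ha V hV := ⟨Set.univ, univ_mem, (h.lower y a ha V hV).mono fun _ hn _ _ => hn⟩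
  upper _ y a ha := by
    obtain ⟨V, hV, hle⟩ := h.upper y a ha
    exact ⟨Set.univ, univ_mem, V, hV, hle.mono fun _ hn _ _ => hn⟩
  tight _ _ a := by
    obtain ⟨K', hK', hle⟩ := h.tight a
    exact ⟨K', hK', hle.mono fun _ hn _ _ => hn⟩

lemma SatisfiesLocalLDP.of_map_isClosedEmbedding [BorelSpace 𝕐] [TopologicalSpace 𝕊]
    [MeasurableSpace 𝕊] [OpensMeasurableSpace 𝕊] {μ : ℕ → Measure 𝕊} {I : 𝕐 → EReal} {f : 𝕊 → 𝕐}
    (hf : IsClosedEmbedding f) (h : SatisfiesLocalLDP (fun n => (μ n).map f) I) :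
    SatisfiesLocalLDP μ fun z => I (f z) :=
  ((h.const (𝕏 := Unit)).of_map_isClosedEmbedding hf).apply ()

section Speed

variable {C : ℕ → ℕ} {α : ℝ}

lemma tendsto_atTop_of_tendsto_div (hα : 0 < α)
    (hC : Tendsto (fun n : ℕ => (C n : ℝ) / n) atTop (𝓝 α)) : Tendsto C atTop atTop := by
  have h : Tendsto (fun n : ℕ => (C n : ℝ) / n * n) atTop atTop :=
    hC.pos_mul_atTop hα tendsto_natCast_atTop_atTop
  refine tendsto_natCast_atTop_iff.1 (h.congr' ?_)
  filter_upwards [eventually_ne_atTop 0] with n hn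
  field_simp

lemma eventually_mul_le_mul_of_tendsto_div
    (hC : Tendsto (fun n : ℕ => (C n : ℝ) / n) atTop (𝓝 α)) {a b : ℝ} (h : α * b < a) :
    ∀ᶠ n : ℕ in atTop, C n * b ≤ n * a := by
  filter_upwards [(hC.mul_const b).eventually_lt_const h, eventually_gt_atTop 0] with n hn hn0
  have hn' : (0 : ℝ) < n := by exact_mod_cast hn0
  rw [div_mul_eq_mul_div, div_lt_iff₀ hn'] at hn
  linarith

lemma eventually_mul_le_mul_of_tendsto_div'
    (hC : Tendsto (fun n : ℕ => (C n : ℝ) / n) atTop (𝓝 α)) {a b : ℝ} (h : a < α * b) :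
    ∀ᶠ n : ℕ in atTop, n * a ≤ C n * b := by
  have h' : α * -b < -a := by linarith
  filter_upwards [eventually_mul_le_mul_of_tendsto_div hC h'] with n hn
  linarith

theorem SatisfiesLocallyUniformLDP.comp_speed {κ : ℕ → 𝕏 → Measure 𝕐} {J : 𝕏 → 𝕐 → EReal}
    (h : SatisfiesLocallyUniformLDP κ J) (hα : 0 < α)
    (hC : Tendsto (fun n : ℕ => (C n : ℝ) / n) atTop (𝓝 α)) :
    SatisfiesLocallyUniformLDP (fun n => κ (C n)) fun x y => α * J x y where
  ne_bot x y := by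
    have hα' : (0 : EReal) ≤ α := by exact_mod_cast hα.le
    simp [EReal.mul_ne_bot, h.ne_bot x y, hα']
  lower x y a ha V hV := by
    rw [mul_comm, ← EReal.lt_div_iff (by exact_mod_cast hα) (EReal.coe_ne_top α),
      ← EReal.coe_div] at ha
    obtain ⟨b, hb, hba⟩ := EReal.lt_iff_exists_real_btwn.1 ha
    rw [EReal.coe_lt_coe_iff, lt_div_iff₀' hα] at hba
    obtain ⟨U, hU, hle⟩ := h.lower x y b hb V hV
    refine ⟨U, hU, ?_⟩
    filter_upwards [(tendsto_atTop_of_tendsto_div hα hC).eventually hle,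
      eventually_mul_le_mul_of_tendsto_div hC hba] with n hn hCn x' hx'
    exact (eexp_mono (neg_le_neg hCn)).trans (hn x' hx')
  upper x y a ha := by
    rw [mul_comm, ← EReal.div_lt_iff (by exact_mod_cast hα) (EReal.coe_ne_top α),
      ← EReal.coe_div] at ha
    obtain ⟨b, hab, hb⟩ := EReal.lt_iff_exists_real_btwn.1 ha
    rw [EReal.coe_lt_coe_iff, div_lt_iff₀' hα] at hab
    obtain ⟨U, hU, V, hV, hle⟩ := h.upper x y b hb
    refine ⟨U, hU, V, hV, ?_⟩
    filter_upwards [(tendsto_atTop_of_tendsto_div hα hC).eventually hle,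
      eventually_mul_le_mul_of_tendsto_div' hC hab] with n hn hCn x' hx'
    exact (hn x' hx').trans (eexp_mono (neg_le_neg hCn))
  tight K hK a := by
    obtain ⟨b, hab⟩ := exists_gt (a / α)
    rw [div_lt_iff₀' hα] at hab
    obtain ⟨K', hK', hle⟩ := h.tight K hK b
    refine ⟨K', hK', ?_⟩
    filter_upwards [(tendsto_atTop_of_tendsto_div hα hC).eventually hle,
      eventually_mul_le_mul_of_tendsto_div' hC hab] with n hn hCn x hx
    exact (hn x hx).trans (eexp_mono (neg_le_neg hCn))

end Speed

end LocallyUniform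

lemma exists_coe_lt_of_add_lt {x y : EReal} (hx : x ≠ ⊥) (hy : y ≠ ⊥) {a : ℝ} (h : x + y < a) :
    ∃ b : ℝ, x < b ∧ y < ((a - b : ℝ) : EReal) := by
  obtain ⟨b, hxb, hb⟩ :=
    EReal.lt_iff_exists_real_btwn.1 ((EReal.lt_sub_iff_add_lt (.inl hy) (.inr hx)).2 h)
  refine ⟨b, hxb, ?_⟩
  rw [EReal.coe_sub]
  refine (EReal.lt_sub_iff_add_lt (.inl (EReal.coe_ne_bot b)) (.inl (EReal.coe_ne_top b))).2 ?_
  rw [add_comm]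
  exact EReal.add_lt_of_lt_sub hb

lemma exists_lt_coe_of_lt_add {x y : EReal} {a : ℝ} (h : a < x + y) :
    ∃ b : ℝ, b < x ∧ ((a - b : ℝ) : EReal) < y := by
  obtain ⟨b, hb, hbx⟩ := EReal.lt_iff_exists_real_btwn.1 (EReal.sub_lt_of_lt_add h)
  refine ⟨b, hbx, ?_⟩
  rw [EReal.coe_sub]
  refine EReal.sub_lt_of_lt_add' ?_
  exact (EReal.sub_lt_iff (.inr (EReal.coe_ne_bot a)) (.inr (EReal.coe_ne_top a))).1 hb

section MarkovSequences

variable {Ω : Type*} [MeasurableSpace Ω] {P : Measure Ω}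

/-- The conditional law of `Y` given `X` is `κ (X ·)`. The condition is stated in integrated form,
so that `κ` need not be known to be measurable. -/
structure IsTransition {𝕏 𝕐 : Type*} [MeasurableSpace 𝕏] [MeasurableSpace 𝕐] (P : Measure Ω)
    (κ : 𝕏 → Measure 𝕐) (X : Ω → 𝕏) (Y : Ω → 𝕐) : Prop where
  measurable_fst : Measurable X
  measurable_snd : Measurable Y
  measure_inter : ∀ A B, MeasurableSet A → MeasurableSet B →
    P (X ⁻¹' A ∩ Y ⁻¹' B) = ∫⁻ ω in X ⁻¹' A, κ (X ω) B ∂P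

section Pair

variable {𝕏 𝕐 : Type*} [MeasurableSpace 𝕏] [MeasurableSpace 𝕐]

namespace IsTransition

variable {κ : 𝕏 → Measure 𝕐} {X : Ω → 𝕏} {Y : Ω → 𝕐} {A : Set 𝕏} {B : Set 𝕐} {c : ℝ≥0∞}

lemma measure_inter_le (h : IsTransition P κ X Y) (hA : MeasurableSet A) (hB : MeasurableSet B)
    (hc : ∀ x ∈ A, κ x B ≤ c) : P (X ⁻¹' A ∩ Y ⁻¹' B) ≤ c * P (X ⁻¹' A) := by
  rw [h.measure_inter A B hA hB, ← setLIntegral_const]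
  exact setLIntegral_mono' (h.measurable_fst hA) fun ω hω => hc (X ω) hω

lemma le_measure_inter (h : IsTransition P κ X Y) (hA : MeasurableSet A) (hB : MeasurableSet B)
    (hc : ∀ x ∈ A, c ≤ κ x B) : c * P (X ⁻¹' A) ≤ P (X ⁻¹' A ∩ Y ⁻¹' B) := by
  rw [h.measure_inter A B hA hB, ← setLIntegral_const]
  exact setLIntegral_mono' (h.measurable_fst hA) fun ω hω => hc (X ω) hω

end IsTransition

lemma isTransition_of_condExp [IsFiniteMeasure P] {κ : 𝕏 → Measure 𝕐} [∀ x, IsFiniteMeasure (κ x)]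
    {X : Ω → 𝕏} {Y : Ω → 𝕐} (hX : Measurable X) (hY : Measurable Y)
    (h : ∀ B, MeasurableSet B → P[(Y ⁻¹' B).indicator (fun _ => (1 : ℝ)) |
      MeasurableSpace.comap X inferInstance] =ᵐ[P] fun ω => (κ (X ω)).real B) :
    IsTransition P κ X Y where
  measurable_fst := hX
  measurable_snd := hY
  measure_inter A B hA hB := by
    have hint : Integrable ((Y ⁻¹' B).indicator fun _ => (1 : ℝ)) P :=
      (integrable_const _).indicator (hY hB)
    have hκint : Integrable (fun ω => (κ (X ω)).real B) P := integrable_condExp.congr (h B hB)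
    have hset : ∫ ω in X ⁻¹' A, (κ (X ω)).real B ∂P = P.real (X ⁻¹' A ∩ Y ⁻¹' B) := by
      rw [← setIntegral_congr_ae (hX hA) ((h B hB).mono fun ω hω _ => hω),
        setIntegral_condExp hX.comap_le hint ⟨A, hA, rfl⟩, integral_indicator_const _ (hY hB),
        smul_eq_mul, mul_one, measureReal_restrict_apply (hY hB), Set.inter_comm]
    rw [← ofReal_measureReal, ← hset, ofReal_integral_eq_lintegral_ofReal hκint.restrict
      (.of_forall fun ω => measureReal_nonneg)]
    exact lintegral_congr fun ω => ofReal_measureReal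

lemma IsTransition.of_comp {𝕎 : Type*} [MeasurableSpace 𝕎] {κ : 𝕏 → Measure 𝕐} {W : Ω → 𝕎}
    {Y : Ω → 𝕐} {φ : 𝕎 → 𝕏} (hφ : Measurable φ) (h : IsTransition P (fun w => κ (φ w)) W Y) :
    IsTransition P κ (fun ω => φ (W ω)) Y where
  measurable_fst := hφ.comp h.measurable_fst
  measurable_snd := h.measurable_snd
  measure_inter A B hA hB := h.measure_inter (φ ⁻¹' A) B (hφ hA) hB

variable [TopologicalSpace 𝕏] [OpensMeasurableSpace 𝕏] [TopologicalSpace 𝕐]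
  [OpensMeasurableSpace 𝕐] {κ : ℕ → 𝕏 → Measure 𝕐} {X : ℕ → Ω → 𝕏} {Y : ℕ → Ω → 𝕐}
  {I : 𝕏 → EReal} {J : 𝕏 → 𝕐 → EReal}

lemma eventually_le_map_prodMk (hI : SatisfiesLocalLDP (fun n => P.map (X n)) I)
    (hJ : SatisfiesLocallyUniformLDP κ J) (hXY : ∀ᶠ n in atTop, IsTransition P (κ n) (X n) (Y n))
    {p : 𝕏 × 𝕐} {a : ℝ} (ha : I p.1 + J p.1 p.2 < a) {W : Set (𝕏 × 𝕐)} (hW : W ∈ 𝓝 p) :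
    ∀ᶠ n : ℕ in atTop, eexp (-(n * a)) ≤ P.map (fun ω => (X n ω, Y n ω)) W := by
  obtain ⟨b, hIb, hJb⟩ := exists_coe_lt_of_add_lt (hI.ne_bot p.1) (hJ.ne_bot p.1 p.2) ha
  obtain ⟨U, V, hU, hpU, hV, hpV, hUV⟩ := mem_nhds_prod_iff'.1 hW
  obtain ⟨U', hU', hκ⟩ := hJ.lower p.1 p.2 (a - b) hJb V (hV.mem_nhds hpV)
  have hA : IsOpen (U ∩ interior U') := hU.inter isOpen_interior
  have hpA : U ∩ interior U' ∈ 𝓝 p.1 := inter_mem (hU.mem_nhds hpU) (interior_mem_nhds.2 hU')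
  filter_upwards [hXY, hκ, hI.lower p.1 b hIb _ hpA] with n hn hκn hIn
  rw [Measure.map_apply hn.measurable_fst hA.measurableSet] at hIn
  calc eexp (-(n * a)) = eexp (-(n * (a - b))) * eexp (-(n * b)) := by
        rw [← eexp_add]
        ring_nf
    _ ≤ eexp (-(n * (a - b))) * P (X n ⁻¹' (U ∩ interior U')) := by gcongr
    _ ≤ P (X n ⁻¹' (U ∩ interior U') ∩ Y n ⁻¹' V) :=
        hn.le_measure_inter hA.measurableSet hV.measurableSet fun x hx =>
          hκn x (interior_subset hx.2)
    _ ≤ P ((fun ω => (X n ω, Y n ω)) ⁻¹' W) :=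
        measure_mono fun ω hω => hUV ⟨hω.1.1, hω.2⟩
    _ ≤ P.map (fun ω => (X n ω, Y n ω)) W :=
        Measure.le_map_apply (hn.measurable_fst.prodMk hn.measurable_snd).aemeasurable W

lemma exists_mem_nhds_map_prodMk_le (hI : SatisfiesLocalLDP (fun n => P.map (X n)) I)
    (hJ : SatisfiesLocallyUniformLDP κ J) (hXY : ∀ᶠ n in atTop, IsTransition P (κ n) (X n) (Y n))
    {p : 𝕏 × 𝕐} {a : ℝ} (ha : a < I p.1 + J p.1 p.2) :
    ∃ W ∈ 𝓝 p, ∀ᶠ n : ℕ in atTop, P.map (fun ω => (X n ω, Y n ω)) W ≤ eexp (-(n * a)) := by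
  obtain ⟨b, hIb, hJb⟩ := exists_lt_coe_of_lt_add ha
  obtain ⟨U, hU, hIU⟩ := hI.upper p.1 b hIb
  obtain ⟨U', hU', V, hV, hκ⟩ := hJ.upper p.1 p.2 (a - b) hJb
  have hA : MeasurableSet (interior (U ∩ U')) := isOpen_interior.measurableSet
  have hB : MeasurableSet (interior V) := isOpen_interior.measurableSet
  refine ⟨interior (U ∩ U') ×ˢ interior V,
    prod_mem_nhds (interior_mem_nhds.2 (inter_mem hU hU')) (interior_mem_nhds.2 hV), ?_⟩
  filter_upwards [hXY, hκ, hIU] with n hn hκn hIn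
  have hfst : P (X n ⁻¹' interior (U ∩ U')) ≤ eexp (-(n * b)) := by
    rw [← Measure.map_apply hn.measurable_fst hA]
    exact (measure_mono (interior_subset.trans Set.inter_subset_left)).trans hIn
  rw [Measure.map_apply (hn.measurable_fst.prodMk hn.measurable_snd) (hA.prod hB)]
  calc P (X n ⁻¹' interior (U ∩ U') ∩ Y n ⁻¹' interior V)
      ≤ eexp (-(n * (a - b))) * P (X n ⁻¹' interior (U ∩ U')) :=
        hn.measure_inter_le hA hB fun x hx =>
          (measure_mono interior_subset).trans (hκn x (interior_subset hx).2)
    _ ≤ eexp (-(n * (a - b))) * eexp (-(n * b)) := by gcongr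
    _ = eexp (-(n * a)) := by
        rw [← eexp_add]
        ring_nf

lemma exists_isCompact_map_prodMk_compl_le [IsProbabilityMeasure P] [T2Space 𝕏] [T2Space 𝕐]
    (hI : SatisfiesLocalLDP (fun n => P.map (X n)) I) (hJ : SatisfiesLocallyUniformLDP κ J)
    (hXY : ∀ᶠ n in atTop, IsTransition P (κ n) (X n) (Y n)) (a : ℝ) :
    ∃ K : Set (𝕏 × 𝕐), IsCompact K ∧
      ∀ᶠ n : ℕ in atTop, P.map (fun ω => (X n ω, Y n ω)) Kᶜ ≤ eexp (-(n * a)) := by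
  obtain ⟨K, hK, hKle⟩ := hI.tight (a + 1)
  obtain ⟨K', hK', hκ⟩ := hJ.tight K hK (a + 1)
  have hmK := hK.measurableSet
  have hmK' := hK'.measurableSet
  refine ⟨K ×ˢ K', hK.prod hK', ?_⟩
  filter_upwards [hXY, hKle, hκ, eventually_mul_eexp_neg_le (m := 2) (by finiteness) (lt_add_one a)]
    with n hn hKn hκn hmul
  rw [Measure.map_apply hn.measurable_fst hmK.compl] at hKn
  rw [Measure.map_apply (hn.measurable_fst.prodMk hn.measurable_snd) (hmK.prod hmK').compl]
  have hcover : (fun ω => (X n ω, Y n ω)) ⁻¹' (K ×ˢ K')ᶜ ⊆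
      X n ⁻¹' Kᶜ ∪ X n ⁻¹' K ∩ Y n ⁻¹' K'ᶜ := by
    intro ω hω
    by_cases hX : X n ω ∈ K
    · exact .inr ⟨hX, fun hY => hω ⟨hX, hY⟩⟩
    · exact .inl hX
  calc P ((fun ω => (X n ω, Y n ω)) ⁻¹' (K ×ˢ K')ᶜ)
      ≤ P (X n ⁻¹' Kᶜ) + P (X n ⁻¹' K ∩ Y n ⁻¹' K'ᶜ) :=
        (measure_mono hcover).trans (measure_union_le _ _)
    _ ≤ eexp (-(n * (a + 1))) + eexp (-(n * (a + 1))) * P (X n ⁻¹' K) :=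
        add_le_add hKn (hn.measure_inter_le hmK hmK'.compl hκn)
    _ ≤ eexp (-(n * (a + 1))) + eexp (-(n * (a + 1))) * 1 := by
        gcongr
        exact prob_le_one
    _ = 2 * eexp (-(n * (a + 1))) := by ring
    _ ≤ eexp (-(n * a)) := hmul

theorem SatisfiesLocalLDP.prodMk [IsProbabilityMeasure P] [T2Space 𝕏] [T2Space 𝕐]
    (hI : SatisfiesLocalLDP (fun n => P.map (X n)) I) (hJ : SatisfiesLocallyUniformLDP κ J)
    (hXY : ∀ᶠ n in atTop, IsTransition P (κ n) (X n) (Y n)) :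
    SatisfiesLocalLDP (fun n => P.map fun ω => (X n ω, Y n ω)) fun p => I p.1 + J p.1 p.2 where
  ne_bot p := by simp [EReal.add_eq_bot_iff, hI.ne_bot p.1, hJ.ne_bot p.1 p.2]
  lower _ _ ha _ hW := eventually_le_map_prodMk hI hJ hXY ha hW
  upper _ _ ha := exists_mem_nhds_map_prodMk_le hI hJ hXY ha
  tight a := exists_isCompact_map_prodMk_compl_le hI hJ hXY a

end Pair

/-- `X 0, …, X L` is a Markov sequence with transition kernels `κ 0, …, κ (L - 1)`: the conditional
law of `X (ℓ + 1)` given `X 0, …, X ℓ` is `κ ℓ (X ℓ ·)`. -/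
structure IsMarkovSequence {L : ℕ} {S : Fin (L + 1) → Type*} [∀ i, MeasurableSpace (S i)]
    (P : Measure Ω) (κ : (ℓ : Fin L) → S ℓ.castSucc → Measure (S ℓ.succ))
    (X : (i : Fin (L + 1)) → Ω → S i) : Prop where
  measurable : ∀ i, Measurable (X i)
  isTransition : ∀ ℓ : Fin L,
    IsTransition P (fun x : (i : {i : Fin (L + 1) // i ≤ ℓ.castSucc}) → S i =>
      κ ℓ (x ⟨ℓ.castSucc, le_rfl⟩)) (fun ω i => X i ω) (X ℓ.succ)

namespace IsMarkovSequence

variable {L : ℕ} {S : Fin (L + 2) → Type*} [∀ i, MeasurableSpace (S i)]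
  {κ : (ℓ : Fin (L + 1)) → S ℓ.castSucc → Measure (S ℓ.succ)} {X : (i : Fin (L + 2)) → Ω → S i}

lemma init (h : IsMarkovSequence P κ X) :
    IsMarkovSequence (S := fun i : Fin (L + 1) => S i.castSucc) P (fun ℓ => κ ℓ.castSucc)
      fun i => X i.castSucc where
  measurable i := h.measurable i.castSucc
  isTransition ℓ := by
    have hφ : Measurable fun (x : (i : {i : Fin (L + 2) // i ≤ ℓ.castSucc.castSucc}) → S i)
        (i : {i : Fin (L + 1) // i ≤ ℓ.castSucc}) => x ⟨i.1.castSucc, i.2⟩ := by fun_prop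
    exact IsTransition.of_comp (W := fun ω i => X (Subtype.val i) ω) hφ (h.isTransition ℓ.castSucc)

lemma isTransition_last (h : IsMarkovSequence P κ X) :
    IsTransition P (fun x : (i : Fin (L + 1)) → S i.castSucc => κ (Fin.last L) (x (Fin.last L)))
      (fun ω i => X i.castSucc ω) (X (Fin.last (L + 1))) := by
  have hφ : Measurable fun (x : (i : {i : Fin (L + 2) // i ≤ (Fin.last L).castSucc}) → S i)
      (i : Fin (L + 1)) => x ⟨i.castSucc, Fin.le_last i⟩ := by fun_prop
  exact IsTransition.of_comp (W := fun ω i => X (Subtype.val i) ω) hφ (h.isTransition (Fin.last L))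

end IsMarkovSequence

lemma isClosedEmbedding_init_last {L : ℕ} {S : Fin (L + 1) → Type*} [∀ i, TopologicalSpace (S i)]
    [∀ i, T2Space (S i)] :
    IsClosedEmbedding fun x : (i : Fin (L + 1)) → S i => (Fin.init x, x (Fin.last L)) :=
  Function.LeftInverse.isClosedEmbedding (f := fun p => Fin.snoc p.1 p.2)
    (fun x => Fin.snoc_init_self x) (by fun_prop) (by fun_prop)

theorem IsMarkovSequence.satisfiesLocalLDP [IsProbabilityMeasure P] {L : ℕ}
    {S : Fin (L + 1) → Type*} [∀ i, TopologicalSpace (S i)] [∀ i, MeasurableSpace (S i)]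
    [∀ i, BorelSpace (S i)] [∀ i, SecondCountableTopology (S i)] [∀ i, T2Space (S i)]
    {κ : ℕ → (ℓ : Fin L) → S ℓ.castSucc → Measure (S ℓ.succ)} {X : ℕ → (i : Fin (L + 1)) → Ω → S i}
    {I : S 0 → EReal} {J : (ℓ : Fin L) → S ℓ.castSucc → S ℓ.succ → EReal}
    (hX : ∀ᶠ n in atTop, IsMarkovSequence P (κ n) (X n))
    (hI : SatisfiesLocalLDP (fun n => P.map (X n 0)) I)
    (hJ : ∀ ℓ, SatisfiesLocallyUniformLDP (fun n => κ n ℓ) (J ℓ)) :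
    SatisfiesLocalLDP (fun n => P.map fun ω i => X n i ω)
      fun x => I (x 0) + ∑ ℓ, J ℓ (x ℓ.castSucc) (x ℓ.succ) := by
  induction L with
  | zero =>
    simp only [Finset.univ_eq_empty, Finset.sum_empty, add_zero]
    refine (hI.congr ?_).of_map_isClosedEmbedding
      (Homeomorph.piUnique (α := Fin 1) S).isClosedEmbedding
    filter_upwards [hX] with n hn
    exact (Measure.map_map (measurable_pi_apply 0) (measurable_pi_lambda _ hn.measurable)).symm
  | succ L ih =>
    have hpath := ih (S := fun i => S i.castSucc) (hX.mono fun n hn => hn.init) hI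
      fun ℓ => hJ ℓ.castSucc
    have hlast := (hJ (Fin.last L)).comp_continuous
      (φ := fun x : (i : Fin (L + 1)) → S i.castSucc => x (Fin.last L)) (by fun_prop)
    have hpair := hpath.prodMk hlast (hX.mono fun n hn => hn.isTransition_last)
    simp only [Fin.sum_univ_castSucc, ← add_assoc]
    refine (hpair.congr ?_).of_map_isClosedEmbedding isClosedEmbedding_init_last
    filter_upwards [hX] with n hn
    exact (Measure.map_map (isClosedEmbedding_init_last (S := S)).continuous.measurable
      (measurable_pi_lambda _ hn.measurable)).symm

end MarkovSequences

section ProductMeasures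

lemma lintegral_pi_prod {ι : Type*} [Fintype ι] {W : ι → Type*} [∀ i, MeasurableSpace (W i)]
    {γ : (i : ι) → Measure (W i)} [∀ i, IsProbabilityMeasure (γ i)] {h : (i : ι) → W i → ℝ≥0∞}
    (hh : ∀ i, Measurable (h i)) :
    ∫⁻ z, ∏ i, h i (z i) ∂(Measure.pi γ) = ∏ i, ∫⁻ w, h i w ∂(γ i) := by
  have hind : iIndepFun (fun i (z : (i : ι) → W i) => h i (z i)) (Measure.pi γ) :=
    iIndepFun_pi fun i => (hh i).aemeasurable
  rw [lintegral_prod_eq_prod_lintegral_of_indepFun Finset.univ _ hind fun i => by fun_prop]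
  exact Finset.prod_congr rfl fun i _ => (measurePreserving_eval γ i).lintegral_comp (hh i)

lemma pi_withDensity {ι : Type*} [Fintype ι] {W : ι → Type*} [∀ i, MeasurableSpace (W i)]
    {γ : (i : ι) → Measure (W i)} [∀ i, IsProbabilityMeasure (γ i)] {h : (i : ι) → W i → ℝ≥0∞}
    (hh : ∀ i, Measurable (h i)) [∀ i, SigmaFinite ((γ i).withDensity (h i))] :
    Measure.pi (fun i => (γ i).withDensity (h i)) =
      (Measure.pi γ).withDensity fun z => ∏ i, h i (z i) := by
  refine Measure.pi_eq fun s hs => ?_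
  have hprod : (Set.univ.pi s).indicator (fun z => ∏ i, h i (z i)) =
      fun z => ∏ i, (s i).indicator (h i) (z i) := by
    classical
    ext z
    simp only [Set.indicator_apply, Finset.prod_ite_zero, Set.mem_univ_pi, Finset.mem_univ,
      true_implies]
  rw [withDensity_apply _ (.univ_pi hs), ← lintegral_indicator (.univ_pi hs), hprod,
    lintegral_pi_prod fun i => (hh i).indicator (hs i)]
  exact Finset.prod_congr rfl fun i _ => by
    rw [lintegral_indicator (hs i), withDensity_apply _ (hs i)]

variable {W : Type*} [MeasurableSpace W] {γ : Measure W}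

lemma measure_pi_mul_le_sum_le [IsProbabilityMeasure γ] {φ : W → ℝ} (hφ : Measurable φ) {b : ℝ}
    (hb : ∫⁻ w, eexp (φ w) ∂γ ≤ eexp b) (n : ℕ) (a : ℝ) :
    (Measure.pi fun _ : Fin n => γ) {z | n * a ≤ ∑ i, φ (z i)} ≤ eexp (-(n * (a - b))) := by
  have hmoment : ∫⁻ z, eexp (∑ i, φ (z i)) ∂(Measure.pi fun _ : Fin n => γ) ≤ eexp (n * b) := by
    simp only [eexp_sum, eexp_natCast_mul]
    rw [lintegral_pi_prod (h := fun _ w => eexp (φ w)) fun _ => by fun_prop, Finset.prod_const,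
      Finset.card_univ, Fintype.card_fin]
    gcongr
  have hset : {z : Fin n → W | n * a ≤ ∑ i, φ (z i)} =
      {z | eexp (n * a) ≤ eexp (∑ i, φ (z i))} := by
    simp only [eexp_le_eexp]
  rw [hset, ← ENNReal.mul_le_mul_iff_right (eexp_pos (n * a)).ne' (eexp_ne_top _)]
  calc _ ≤ ∫⁻ z, eexp (∑ i, φ (z i)) ∂(Measure.pi fun _ : Fin n => γ) :=
        mul_meas_ge_le_lintegral (by fun_prop) _
    _ ≤ eexp (n * b) := hmoment
    _ = eexp (n * a) * eexp (-(n * (a - b))) := by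
        rw [← eexp_add]
        ring_nf

lemma measure_pi_mul_le_sum_le_of_lintegral_le [IsProbabilityMeasure γ] {q : W → ℝ}
    (hq : Measurable q) {t B : ℝ} (ht : 0 < t) (hB : ∫⁻ w, eexp (t * q w) ∂γ ≤ eexp B)
    (n : ℕ) (a : ℝ) : (Measure.pi fun _ : Fin n => γ) {z | n * ((a + B) / t) ≤ ∑ i, q (z i)} ≤
      eexp (-(n * a)) := by
  have h := measure_pi_mul_le_sum_le (hq.const_mul t) hB n (a + B)
  rw [add_sub_cancel_right] at h
  refine (measure_mono fun z hz => ?_).trans h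
  rw [Set.mem_ofPred_eq] at hz ⊢
  rw [← Finset.mul_sum]
  calc n * (a + B) = t * (n * ((a + B) / t)) := by field_simp
    _ ≤ t * ∑ i, q (z i) := by gcongr

lemma lintegral_eexp_add_le {φ ψ : W → ℝ} (hφ : Measurable φ) (hψ : Measurable ψ) {t : ℝ}
    (h0 : 0 ≤ t) (h1 : t ≤ 1) :
    ∫⁻ w, eexp (t * φ w + (1 - t) * ψ w) ∂γ ≤
      (∫⁻ w, eexp (φ w) ∂γ) ^ t * (∫⁻ w, eexp (ψ w) ∂γ) ^ (1 - t) := by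
  simp only [eexp_add, mul_comm _ (φ _), mul_comm _ (ψ _), eexp_mul]
  exact ENNReal.lintegral_mul_norm_pow_le (by fun_prop) (by fun_prop) h0 (sub_nonneg.2 h1)
    (add_sub_cancel t 1)

end ProductMeasures

section SampleMeans

variable {W E : Type*} [NormedAddCommGroup E] [NormedSpace ℝ E]

/-- The mean of `f` over the sample `z`, equal to `0` for the empty sample. -/
def sampleMean (f : W → E) {n : ℕ} (z : Fin n → W) : E :=
  (n : ℝ)⁻¹ • ∑ i, f (z i)

lemma sum_eq_natCast_smul_sampleMean (f : W → E) {n : ℕ} (z : Fin n → W) :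
    ∑ i, f (z i) = (n : ℝ) • sampleMean f z := by
  rcases n.eq_zero_or_pos with rfl | hn
  · simp
  · rw [sampleMean, smul_inv_smul₀ (by positivity)]

lemma sampleMean_sub (f g : W → E) {n : ℕ} (z : Fin n → W) :
    sampleMean (fun w => f w - g w) z = sampleMean f z - sampleMean g z := by
  simp only [sampleMean, Finset.sum_sub_distrib, smul_sub]

lemma natCast_mul_norm_sampleMean_le {f : W → E} {q : W → ℝ} (hfq : ∀ w, ‖f w‖ ≤ q w)
    {n : ℕ} (z : Fin n → W) : n * ‖sampleMean f z‖ ≤ ∑ i, q (z i) := by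
  rw [← Real.norm_natCast, ← norm_smul, ← sum_eq_natCast_smul_sampleMean]
  exact norm_sum_le_of_le _ fun i _ => hfq (z i)

variable [MeasurableSpace W] [MeasurableSpace E] [BorelSpace E] [SecondCountableTopology E]

@[fun_prop]
lemma measurable_sampleMean {f : W → E} (hf : Measurable f) (n : ℕ) :
    Measurable (sampleMean f : (Fin n → W) → E) := by
  unfold sampleMean
  fun_prop

/-- The law of the mean of `f` over `n` independent samples of `γ`. -/
def meanLaw (γ : Measure W) (f : W → E) (n : ℕ) : Measure E :=
  (Measure.pi fun _ : Fin n => γ).map (sampleMean f)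

lemma meanLaw_apply {γ : Measure W} {f : W → E} (hf : Measurable f) (n : ℕ) {B : Set E}
    (hB : MeasurableSet B) :
    meanLaw γ f n B = (Measure.pi fun _ : Fin n => γ) (sampleMean f ⁻¹' B) :=
  Measure.map_apply (measurable_sampleMean hf n) hB

lemma isProbabilityMeasure_meanLaw {γ : Measure W} [IsProbabilityMeasure γ] {f : W → E}
    (hf : Measurable f) (n : ℕ) : IsProbabilityMeasure (meanLaw γ f n) :=
  Measure.isProbabilityMeasure_map (measurable_sampleMean hf n).aemeasurable

lemma meanLaw_eq_map_infinitePi {γ : Measure W} [IsProbabilityMeasure γ] {f : W → E}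
    (hf : Measurable f) (n : ℕ) :
    meanLaw γ f n = (Measure.infinitePi fun _ : ℕ => γ).map
      fun ω => (n : ℝ)⁻¹ • ∑ i ∈ Finset.range n, f (ω i) := by
  rw [meanLaw, ← Measure.infinitePi_eq_pi,
    ← Measure.map_infinitePi_infinitePi_of_inj (P := fun _ : ℕ => γ) (Fin.val_injective (n := n)),
    Measure.map_map (measurable_sampleMean hf n) (by fun_prop)]
  simp only [Function.comp_def, sampleMean, Finset.sum_range]

lemma tendsto_meanLaw_compl_ball [CompleteSpace E] {γ : Measure W} [IsProbabilityMeasure γ]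
    {f : W → E} (hf : Measurable f) (hint : Integrable f γ) {r : ℝ} (hr : 0 < r) :
    Tendsto (fun n => meanLaw γ f n (Metric.ball (∫ w, f w ∂γ) r)ᶜ) atTop (𝓝 0) := by
  set P := Measure.infinitePi fun _ : ℕ => γ
  have heval (i : ℕ) : MeasurePreserving (fun ω : ℕ → W => ω i) P γ :=
    measurePreserving_eval_infinitePi _ i
  have hmean : ∫ ω, f (ω 0) ∂P = ∫ w, f w ∂γ := by
    rw [← (heval 0).map_eq,
      integral_map (heval 0).aemeasurable hf.aestronglyMeasurable]
  have hident (i : ℕ) : IdentDistrib (fun ω : ℕ → W => f (ω i)) (fun ω => f (ω 0)) P P :=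
    IdentDistrib.comp ⟨(heval i).aemeasurable, (heval 0).aemeasurable,
      (heval i).map_eq.trans (heval 0).map_eq.symm⟩ hf
  have hlaw := strong_law_ae (fun i (ω : ℕ → W) => f (ω i))
    ((heval 0).integrable_comp_of_integrable hint)
    (fun i j hij => (iIndepFun_infinitePi fun _ => hf).indepFun hij) hident
  have hprob := tendstoInMeasure_of_tendsto_ae
    (fun n => Measurable.aestronglyMeasurable (by fun_prop)) hlaw
  refine (tendstoInMeasure_iff_dist.1 hprob r hr).congr fun n => ?_
  rw [meanLaw_eq_map_infinitePi hf, Measure.map_apply (by fun_prop) measurableSet_ball.compl, hmean]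
  congr 1 with ω
  simp

lemma eventually_half_le_meanLaw_ball [CompleteSpace E] {γ : Measure W} [IsProbabilityMeasure γ]
    {f : W → E} (hf : Measurable f) (hint : Integrable f γ) {r : ℝ} (hr : 0 < r) :
    ∀ᶠ n in atTop, 1 / 2 ≤ meanLaw γ f n (Metric.ball (∫ w, f w ∂γ) r) := by
  filter_upwards [(tendsto_meanLaw_compl_ball hf hint hr).eventually_le_const
    (show (0 : ℝ≥0∞) < 1 / 2 by simp)] with n hn
  have := isProbabilityMeasure_meanLaw (γ := γ) hf n
  rw [← compl_compl (Metric.ball _ _), prob_compl_eq_one_sub measurableSet_ball.compl,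
    ← ENNReal.one_sub_inv_two.trans (one_div 2).symm, ← one_div]
  exact tsub_le_tsub_left hn 1

end SampleMeans

section CramerRate

open scoped RealInnerProductSpace

variable {W : Type*} [MeasurableSpace W] {E : Type*} [NormedAddCommGroup E] [InnerProductSpace ℝ E]
  {γ : Measure W} {f : W → E} {y : E} {c : ℝ}

/-- Cramér's rate function of the sample means of `f` under `γ`: the Legendre transform of
`θ ↦ log ∫ exp ⟪θ, f⟫ dγ`, with `log ∞ = ∞`. -/
def cramerRate (γ : Measure W) (f : W → E) (y : E) : EReal :=
  ⨆ θ : E, ((⟪θ, y⟫ : ℝ) : EReal) - ENNReal.log (∫⁻ w, eexp ⟪θ, f w⟫ ∂γ)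

lemma coe_sub_log_le_coe {a : ℝ} {m : ℝ≥0∞} :
    (a : EReal) - ENNReal.log m ≤ c ↔ eexp (a - c) ≤ m := by
  rw [EReal.sub_le_iff_le_add (.inr (EReal.coe_ne_top _)) (.inr (EReal.coe_ne_bot _)), add_comm,
    ← EReal.sub_le_iff_le_add (.inl (EReal.coe_ne_bot _)) (.inl (EReal.coe_ne_top _)),
    ← EReal.coe_sub, ← log_eexp, ENNReal.log_le_log_iff]

lemma cramerRate_le_coe :
    cramerRate γ f y ≤ c ↔ ∀ θ, eexp (⟪θ, y⟫ - c) ≤ ∫⁻ w, eexp ⟪θ, f w⟫ ∂γ := by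
  simp only [cramerRate, iSup_le_iff, coe_sub_log_le_coe]

lemma coe_lt_cramerRate :
    (c : EReal) < cramerRate γ f y ↔ ∃ θ, ∫⁻ w, eexp ⟪θ, f w⟫ ∂γ < eexp (⟪θ, y⟫ - c) := by
  simpa only [not_le, not_forall] using cramerRate_le_coe.not

lemma cramerRate_nonneg [IsProbabilityMeasure γ] : 0 ≤ cramerRate γ f y := by
  unfold cramerRate
  simpa using le_iSup (fun θ : E => ((⟪θ, y⟫ : ℝ) : EReal) -
    ENNReal.log (∫⁻ w, eexp ⟪θ, f w⟫ ∂γ)) 0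

/-- The cumulant generating function `θ ↦ log ∫ exp ⟪θ, f⟫ dγ` of a vector-valued function.
It is meaningful when the integral is finite and positive, as it is for bounded `f` and finite
`γ ≠ 0`. -/
def logMGF (γ : Measure W) (f : W → E) (θ : E) : ℝ :=
  Real.log (∫ w, Real.exp ⟪θ, f w⟫ ∂γ)

lemma logMGF_zero_nonpos (hγ : γ Set.univ ≤ 1) : logMGF γ f 0 ≤ 0 := by
  simp only [logMGF, inner_zero_left, Real.exp_zero, integral_const, smul_eq_mul, mul_one]
  exact Real.log_nonpos measureReal_nonneg (ENNReal.toReal_mono ENNReal.one_ne_top hγ)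

lemma withDensity_indicator_eexp_sub_logMGF {A : Set W} [NeZero (γ.restrict A)]
    (hA : MeasurableSet A) {θ : E}
    (hint : Integrable (fun w => Real.exp ⟪θ, f w⟫) (γ.restrict A)) :
    γ.withDensity (A.indicator fun w => eexp (⟪θ, f w⟫ - logMGF (γ.restrict A) f θ)) =
      (γ.restrict A).tilted fun w => ⟪θ, f w⟫ := by
  simp only [withDensity_indicator hA, Measure.tilted, eexp, logMGF, Real.exp_sub,
    Real.exp_log (integral_exp_pos hint)]

end CramerRate

section BoundedTilting

open scoped RealInnerProductSpace

variable {W : Type*} [MeasurableSpace W]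
  {E : Type*} [NormedAddCommGroup E] [InnerProductSpace ℝ E] [FiniteDimensional ℝ E]
  [MeasurableSpace E] [BorelSpace E]
  {κ : Measure W} {f : W → E} {M : ℝ}

lemma integrable_tilted_of_norm_le (hf : Measurable f) (hM : ∀ᵐ w ∂κ, ‖f w‖ ≤ M) (g : W → ℝ) :
    Integrable f (κ.tilted g) :=
  .of_bound hf.aestronglyMeasurable M ((tilted_absolutelyContinuous κ g).ae_le hM)

variable [IsFiniteMeasure κ]

lemma integrable_exp_inner_of_norm_le (hf : Measurable f) (hM : ∀ᵐ w ∂κ, ‖f w‖ ≤ M) (θ : E) :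
    Integrable (fun w => Real.exp ⟪θ, f w⟫) κ := by
  refine .of_bound (by fun_prop) (Real.exp (‖θ‖ * M)) ?_
  filter_upwards [hM] with w hw
  rw [Real.norm_eq_abs, Real.abs_exp, Real.exp_le_exp]
  exact (real_inner_le_norm _ _).trans (by gcongr)

lemma continuous_integral_exp_inner (hf : Measurable f) (hM : ∀ᵐ w ∂κ, ‖f w‖ ≤ M) :
    Continuous fun θ : E => ∫ w, Real.exp ⟪θ, f w⟫ ∂κ := by
  refine continuous_iff_continuousAt.2 fun θ => ?_
  refine continuousAt_of_dominated (bound := fun _ => Real.exp ((‖θ‖ + 1) * M))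
    (Eventually.of_forall fun _ => by fun_prop) ?_ (integrable_const _)
    (Eventually.of_forall fun w => by fun_prop)
  filter_upwards [continuous_norm.continuousAt.eventually_lt continuousAt_const
    (lt_add_one ‖θ‖)] with x hx
  filter_upwards [hM] with w hw
  rw [Real.norm_eq_abs, Real.abs_exp, Real.exp_le_exp]
  exact (real_inner_le_norm _ _).trans (by gcongr)

lemma lintegral_eexp_inner_eq_ofReal (hf : Measurable f) (hM : ∀ᵐ w ∂κ, ‖f w‖ ≤ M) (θ : E) :
    ∫⁻ w, eexp ⟪θ, f w⟫ ∂κ = ENNReal.ofReal (∫ w, Real.exp ⟪θ, f w⟫ ∂κ) :=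
  (ofReal_integral_eq_lintegral_ofReal (integrable_exp_inner_of_norm_le hf hM θ)
    (Eventually.of_forall fun _ => (Real.exp_pos _).le)).symm

lemma eexp_le_lintegral_eexp_inner_iff [NeZero κ] (hf : Measurable f) (hM : ∀ᵐ w ∂κ, ‖f w‖ ≤ M)
    {θ : E} {t : ℝ} : eexp t ≤ ∫⁻ w, eexp ⟪θ, f w⟫ ∂κ ↔ t ≤ logMGF κ f θ := by
  have hpos := integral_exp_pos (integrable_exp_inner_of_norm_le hf hM θ)
  rw [lintegral_eexp_inner_eq_ofReal hf hM, eexp, ENNReal.ofReal_le_ofReal_iff hpos.le, logMGF,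
    Real.le_log_iff_exp_le hpos]

lemma continuous_logMGF [NeZero κ] (hf : Measurable f) (hM : ∀ᵐ w ∂κ, ‖f w‖ ≤ M) :
    Continuous (logMGF κ f) :=
  (continuous_integral_exp_inner hf hM).log fun θ =>
    (integral_exp_pos (integrable_exp_inner_of_norm_le hf hM θ)).ne'

lemma logMGF_add_smul [NeZero κ] (hf : Measurable f) (hM : ∀ᵐ w ∂κ, ‖f w‖ ≤ M) (θ v : E) (t : ℝ) :
    logMGF κ f (θ + t • v) =
      logMGF κ f θ + cgf (fun w => ⟪v, f w⟫) (κ.tilted fun w => ⟪θ, f w⟫) t := by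
  have hpos (x : E) := integral_exp_pos (integrable_exp_inner_of_norm_le hf hM x)
  have hmgf : mgf (fun w => ⟪v, f w⟫) (κ.tilted fun w => ⟪θ, f w⟫) t =
      (∫ w, Real.exp ⟪θ + t • v, f w⟫ ∂κ) / ∫ w, Real.exp ⟪θ, f w⟫ ∂κ := by
    rw [mgf, integral_exp_tilted]
    simp only [Pi.add_apply, inner_add_left, real_inner_smul_left]
  rw [cgf, hmgf, Real.log_div (hpos _).ne' (hpos _).ne', logMGF, logMGF, add_sub_cancel]

lemma hasDerivAt_logMGF_add_smul [NeZero κ] (hf : Measurable f) (hM : ∀ᵐ w ∂κ, ‖f w‖ ≤ M)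
    (θ v : E) :
    HasDerivAt (fun t : ℝ => logMGF κ f (θ + t • v))
      ⟪v, ∫ w, f w ∂(κ.tilted fun w => ⟪θ, f w⟫)⟫ 0 := by
  set ρ := κ.tilted fun w => ⟪θ, f w⟫
  have : IsProbabilityMeasure ρ :=
    isProbabilityMeasure_tilted (integrable_exp_inner_of_norm_le hf hM θ)
  have hset : integrableExpSet (fun w => ⟪v, f w⟫) ρ = Set.univ := by
    refine Set.eq_univ_of_forall fun t => ?_
    refine integrable_exp_mul_of_mem_Icc (a := -(‖v‖ * M)) (b := ‖v‖ * M) (by fun_prop) ?_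
    filter_upwards [(tilted_absolutelyContinuous κ _).ae_le hM] with w hw
    rw [Set.mem_Icc, ← abs_le]
    exact (abs_real_inner_le_norm _ _).trans (by gcongr)
  have hzero : (0 : ℝ) ∈ interior (integrableExpSet (fun w => ⟪v, f w⟫) ρ) := by simp [hset]
  have hcgf := (analyticAt_cgf hzero).differentiableAt.hasDerivAt
  rw [deriv_cgf_zero hzero, probReal_univ, div_one,
    integral_inner (integrable_tilted_of_norm_le hf hM _)] at hcgf
  simpa only [logMGF_add_smul hf hM] using hcgf.const_add (logMGF κ f θ)

lemma integral_tilted_of_forall_penalised_logMGF_le [NeZero κ] (hf : Measurable f)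
    (hM : ∀ᵐ w ∂κ, ‖f w‖ ≤ M) {y θ : E} {δ : ℝ}
    (hmin : ∀ x : E, δ * ‖θ‖ ^ 2 - ⟪θ, y⟫ + logMGF κ f θ ≤
      δ * ‖x‖ ^ 2 - ⟪x, y⟫ + logMGF κ f x) :
    ∫ w, f w ∂(κ.tilted fun w => ⟪θ, f w⟫) = y - (2 * δ) • θ := by
  refine ext_inner_left ℝ fun v => ?_
  have hline : HasDerivAt (fun t : ℝ => θ + t • v) v 0 := by
    simpa using ((hasDerivAt_id (0 : ℝ)).smul_const v).const_add θ
  have hquad : HasDerivAt (fun t : ℝ => δ * ‖θ + t • v‖ ^ 2 - ⟪θ + t • v, y⟫)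
      (δ * (2 * ⟪θ, v⟫) - ⟪v, y⟫) 0 := by
    simpa using (hline.norm_sq.const_mul δ).fun_sub (hline.inner ℝ (hasDerivAt_const 0 y))
  have hlocal : IsLocalMin (fun t : ℝ => δ * ‖θ + t • v‖ ^ 2 - ⟪θ + t • v, y⟫ +
      logMGF κ f (θ + t • v)) 0 :=
    Eventually.of_forall fun t => by simpa using hmin (θ + t • v)
  have hzero := hlocal.hasDerivAt_eq_zero (hquad.add (hasDerivAt_logMGF_add_smul hf hM θ v))
  rw [inner_sub_right, real_inner_smul_right, real_inner_comm θ v]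
  linarith

lemma exists_forall_penalised_logMGF_le [NeZero κ] (hf : Measurable f)
    (hM : ∀ᵐ w ∂κ, ‖f w‖ ≤ M) {y : E} {c δ : ℝ} (hδ : 0 < δ)
    (hlow : ∀ θ, ⟪θ, y⟫ - c - δ * ‖θ‖ ^ 2 ≤ logMGF κ f θ) :
    ∃ θ : E, ∀ x : E, 2 * δ * ‖θ‖ ^ 2 - ⟪θ, y⟫ + logMGF κ f θ ≤
      2 * δ * ‖x‖ ^ 2 - ⟪x, y⟫ + logMGF κ f x := by
  have hcont := continuous_logMGF hf hM
  refine Continuous.exists_forall_le (by fun_prop) (tendsto_atTop_mono (fun θ => ?_)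
    (tendsto_atTop_add_const_right _ (-c) (((tendsto_pow_atTop two_ne_zero).comp
      (tendsto_norm_cocompact_atTop (E := E))).const_mul_atTop hδ)))
  dsimp only [Function.comp]
  linarith [hlow θ]

lemma exists_tilted_mean_close [NeZero κ] (hκ : κ Set.univ ≤ 1) (hf : Measurable f)
    (hM : ∀ᵐ w ∂κ, ‖f w‖ ≤ M) {y : E} {c δ r : ℝ} (hδ : 0 < δ) (hr : 0 < r)
    (hδr : 16 * δ * c < r ^ 2) (hlow : ∀ θ, ⟪θ, y⟫ - c - δ * ‖θ‖ ^ 2 ≤ logMGF κ f θ) :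
    ∃ θ : E, ∫ w, f w ∂(κ.tilted fun w => ⟪θ, f w⟫) ∈ Metric.ball y r ∧
      ⟪θ, ∫ w, f w ∂(κ.tilted fun w => ⟪θ, f w⟫)⟫ - logMGF κ f θ ≤ c := by
  obtain ⟨θ, hθ⟩ := exists_forall_penalised_logMGF_le hf hM hδ hlow
  have hθ_norm : δ * ‖θ‖ ^ 2 ≤ c := by
    have hθ0 := hθ 0
    simp only [norm_zero, inner_zero_left] at hθ0
    linarith [hlow θ, logMGF_zero_nonpos (f := f) hκ]
  refine ⟨θ, ?_, ?_⟩
  · rw [integral_tilted_of_forall_penalised_logMGF_le hf hM hθ, mem_ball_iff_norm,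
      sub_sub_cancel_left, norm_neg, norm_smul, Real.norm_of_nonneg (by positivity)]
    refine lt_of_pow_lt_pow_left₀ 2 hr.le ?_
    calc (2 * (2 * δ) * ‖θ‖) ^ 2 = 16 * δ * (δ * ‖θ‖ ^ 2) := by ring
      _ ≤ 16 * δ * c := by gcongr
      _ < r ^ 2 := hδr
  · rw [integral_tilted_of_forall_penalised_logMGF_le hf hM hθ, inner_sub_right,
      real_inner_smul_right, real_inner_self_eq_norm_sq]
    linarith [hlow θ, mul_nonneg hδ.le (sq_nonneg ‖θ‖)]

end BoundedTilting

section CramerLowerBound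

open scoped RealInnerProductSpace

lemma inner_sub_sub_mul_sq_le {E : Type*} [NormedAddCommGroup E] [InnerProductSpace ℝ E] {y θ : E}
    {c δ M : ℝ} (hδ : 0 < δ) (h1 : 1 ≤ ‖θ‖) (hθ : (‖y‖ + M + |c| + 1) / δ ≤ ‖θ‖) :
    ⟪θ, y⟫ - c - δ * ‖θ‖ ^ 2 ≤ -(‖θ‖ * M) - 1 := by
  have hinner := real_inner_le_norm θ y
  have hc : -c + 1 ≤ ‖θ‖ * (|c| + 1) :=
    (by linarith [neg_abs_le c] : -c + 1 ≤ 1 * (|c| + 1)).trans (by gcongr)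
  have hsq : ‖θ‖ * (‖y‖ + M + |c| + 1) ≤ ‖θ‖ * (‖θ‖ * δ) := by
    gcongr
    exact (div_le_iff₀ hδ).1 hθ
  linarith

variable {W F : Type*} [NormedAddCommGroup F]

lemma monotone_setOf_norm_le (f : W → F) :
    Monotone fun M : ℕ => {w | ‖f w‖ ≤ M} :=
  fun _ _ hab w (hw : ‖f w‖ ≤ _) => hw.trans (Nat.cast_le.2 hab)

lemma iUnion_setOf_norm_le (f : W → F) :
    ⋃ M : ℕ, {w | ‖f w‖ ≤ M} = Set.univ :=
  Set.eq_univ_of_forall fun w => Set.mem_iUnion.2 (exists_nat_ge ‖f w‖)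

variable [MeasurableSpace W] {γ : Measure W}

lemma ae_restrict_norm_le [MeasurableSpace F] [BorelSpace F] {f : W → F} (hf : Measurable f)
    (M : ℝ) : ∀ᵐ w ∂(γ.restrict {w | ‖f w‖ ≤ M}), ‖f w‖ ≤ M :=
  ae_restrict_mem (measurableSet_le hf.norm measurable_const)

lemma exists_half_le_measure_norm_le [IsProbabilityMeasure γ] (f : W → F) :
    ∃ M : ℕ, 1 / 2 ≤ γ {w | ‖f w‖ ≤ M} := by
  have htendsto := tendsto_measure_iUnion_atTop (μ := γ) (monotone_setOf_norm_le f)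
  rw [iUnion_setOf_norm_le, measure_univ] at htendsto
  exact (htendsto.eventually_const_le (show (1 / 2 : ℝ≥0∞) < 1 by simp)).exists

variable {E : Type*} [NormedAddCommGroup E] [InnerProductSpace ℝ E] [MeasurableSpace E]
  [BorelSpace E] {f : W → E}

lemma eexp_neg_le_setLIntegral_eexp_inner (hf : Measurable f) {M : ℝ}
    (hM : 1 / 2 ≤ γ {w | ‖f w‖ ≤ M}) (θ : E) :
    eexp (-(‖θ‖ * M) - 1) ≤ ∫⁻ w in {w | ‖f w‖ ≤ M}, eexp ⟪θ, f w⟫ ∂γ := by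
  have hhalf : eexp (-1) ≤ 1 / 2 := by
    rw [one_div, eexp, Real.exp_neg, ENNReal.ofReal_inv_of_pos (Real.exp_pos 1),
      ENNReal.inv_le_inv, ENNReal.ofNat_le_ofReal]
    linarith [Real.add_one_le_exp 1]
  calc eexp (-(‖θ‖ * M) - 1) = eexp (-(‖θ‖ * M)) * eexp (-1) := by rw [← eexp_add, sub_eq_add_neg]
    _ ≤ eexp (-(‖θ‖ * M)) * γ {w | ‖f w‖ ≤ M} := by gcongr; exact hhalf.trans hM
    _ = ∫⁻ _ in {w | ‖f w‖ ≤ M}, eexp (-(‖θ‖ * M)) ∂γ := (setLIntegral_const _ _).symm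
    _ ≤ ∫⁻ w in {w | ‖f w‖ ≤ M}, eexp ⟪θ, f w⟫ ∂γ := by
        refine lintegral_mono_ae ?_
        filter_upwards [ae_restrict_norm_le hf M] with w hw
        gcongr
        refine le_trans ?_ (neg_le_of_abs_le (abs_real_inner_le_norm θ (f w)))
        gcongr

variable [FiniteDimensional ℝ E]

lemma exists_forall_eexp_lt_setLIntegral [IsFiniteMeasure γ] (hf : Measurable f) {K : Set E}
    (hK : IsCompact K) {g : E → ℝ} (hg : Continuous g)
    (hlt : ∀ θ ∈ K, eexp (g θ) < ∫⁻ w, eexp ⟪θ, f w⟫ ∂γ) :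
    ∃ M : ℕ, ∀ θ ∈ K, eexp (g θ) < ∫⁻ w in {w | ‖f w‖ ≤ M}, eexp ⟪θ, f w⟫ ∂γ := by
  have hcont (M : ℕ) :
      Continuous fun θ : E => ∫⁻ w in {w | ‖f w‖ ≤ M}, eexp ⟪θ, f w⟫ ∂γ := by
    simp only [lintegral_eexp_inner_eq_ofReal hf (ae_restrict_norm_le hf M)]
    exact ENNReal.continuous_ofReal.comp
      (continuous_integral_exp_inner hf (ae_restrict_norm_le hf M))
  refine hK.elim_directed_cover
    (fun M : ℕ => {θ | eexp (g θ) < ∫⁻ w in {w | ‖f w‖ ≤ M}, eexp ⟪θ, f w⟫ ∂γ})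
    (fun M => isOpen_lt (by fun_prop) (hcont M)) (fun θ hθ => ?_)
    (Monotone.directed_le fun a b hab θ hθ =>
      lt_of_lt_of_le hθ (lintegral_mono_set (monotone_setOf_norm_le f hab)))
  have hsup := hlt θ hθ
  rw [← setLIntegral_univ, ← iUnion_setOf_norm_le f,
    setLIntegral_iUnion_of_directed _ (monotone_setOf_norm_le f).directed_le, lt_iSup_iff] at hsup
  exact Set.mem_iUnion.2 hsup

/-- The quadratic correction is what makes the lower bound on the cumulant generating function
survive the truncation of `f` uniformly in `θ`. -/
lemma exists_le_logMGF_restrict [IsProbabilityMeasure γ] (hf : Measurable f) {y : E} {c c' δ : ℝ}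
    (hc : cramerRate γ f y ≤ c) (hcc' : c < c') (hδ : 0 < δ) :
    ∃ M : ℕ, NeZero (γ.restrict {w | ‖f w‖ ≤ M}) ∧
      ∀ θ, ⟪θ, y⟫ - c' - δ * ‖θ‖ ^ 2 ≤ logMGF (γ.restrict {w | ‖f w‖ ≤ M}) f θ := by
  obtain ⟨M₁, hM₁⟩ := exists_half_le_measure_norm_le (γ := γ) f
  set R : ℝ := max 1 ((‖y‖ + M₁ + |c'| + 1) / δ)
  obtain ⟨M₂, hM₂⟩ := exists_forall_eexp_lt_setLIntegral hf (isCompact_closedBall (0 : E) R)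
    (g := fun θ => ⟪θ, y⟫ - c') (by fun_prop) fun θ _ =>
    (eexp_lt_eexp.2 (by linarith)).trans_le (cramerRate_le_coe.1 hc θ)
  have hmono {M : ℕ} (h : M ≤ max M₁ M₂) : {w | ‖f w‖ ≤ M} ⊆ {w | ‖f w‖ ≤ (max M₁ M₂ : ℕ)} :=
    monotone_setOf_norm_le f h
  have hne : NeZero (γ.restrict {w | ‖f w‖ ≤ (max M₁ M₂ : ℕ)}) := ⟨fun h0 => by
    have hpos := hM₁.trans (measure_mono (hmono (le_max_left _ _)))
    rw [Measure.restrict_eq_zero.1 h0] at hpos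
    simp at hpos⟩
  refine ⟨max M₁ M₂, hne, fun θ => ?_⟩
  rw [← eexp_le_lintegral_eexp_inner_iff hf (ae_restrict_norm_le hf _)]
  rcases le_total ‖θ‖ R with hθ | hθ
  · calc eexp (⟪θ, y⟫ - c' - δ * ‖θ‖ ^ 2) ≤ eexp (⟪θ, y⟫ - c') :=
          eexp_mono (sub_le_self _ (by positivity))
      _ ≤ ∫⁻ w in {w | ‖f w‖ ≤ M₂}, eexp ⟪θ, f w⟫ ∂γ :=
          (hM₂ θ (mem_closedBall_zero_iff.2 hθ)).le
      _ ≤ _ := lintegral_mono_set (hmono (le_max_right _ _))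
  · calc eexp (⟪θ, y⟫ - c' - δ * ‖θ‖ ^ 2) ≤ eexp (-(‖θ‖ * M₁) - 1) :=
          eexp_mono (inner_sub_sub_mul_sq_le hδ ((le_max_left _ _).trans hθ)
            ((le_max_right _ _).trans hθ))
      _ ≤ ∫⁻ w in {w | ‖f w‖ ≤ M₁}, eexp ⟪θ, f w⟫ ∂γ :=
          eexp_neg_le_setLIntegral_eexp_inner hf hM₁ θ
      _ ≤ _ := lintegral_mono_set (hmono (le_max_left _ _))

lemma exists_withDensity_mean_mem [IsProbabilityMeasure γ] (hf : Measurable f) {y : E} {c : ℝ}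
    (hc : cramerRate γ f y < c) {U : Set E} (hU : U ∈ 𝓝 y) :
    ∃ (h : W → ℝ≥0∞) (θ : E) (b : ℝ), Measurable h ∧ (∀ w, h w ≤ eexp (⟪θ, f w⟫ - b)) ∧
      IsProbabilityMeasure (γ.withDensity h) ∧ Integrable f (γ.withDensity h) ∧
      ∫ w, f w ∂(γ.withDensity h) ∈ U ∧ ⟪θ, ∫ w, f w ∂(γ.withDensity h)⟫ - b ≤ c := by
  obtain ⟨c₁, hc₁, hc₁c⟩ := EReal.lt_iff_exists_real_btwn.1 hc
  obtain ⟨r, hr, hrU⟩ := Metric.mem_nhds_iff.1 hU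
  have hδ : 0 < r ^ 2 / (16 * (|c| + 1)) := by positivity
  obtain ⟨M, _, hlow⟩ := exists_le_logMGF_restrict hf hc₁.le (EReal.coe_lt_coe_iff.1 hc₁c) hδ
  set A := {w | ‖f w‖ ≤ M}
  have hA : MeasurableSet A := measurableSet_le hf.norm measurable_const
  have hM : ∀ᵐ w ∂(γ.restrict A), ‖f w‖ ≤ M := ae_restrict_norm_le hf M
  have hδr : 16 * (r ^ 2 / (16 * (|c| + 1))) * c < r ^ 2 := by
    rw [← mul_div_assoc, mul_div_mul_left _ _ (by norm_num), div_mul_eq_mul_div,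
      div_lt_iff₀ (by positivity)]
    gcongr
    exact (le_abs_self c).trans_lt (lt_add_one _)
  obtain ⟨θ, hmem, hθ⟩ := exists_tilted_mean_close
    ((Measure.restrict_apply_univ A).trans_le prob_le_one) hf hM hδ hr hδr hlow
  have hint := integrable_exp_inner_of_norm_le hf hM θ
  refine ⟨A.indicator fun w => eexp (⟪θ, f w⟫ - logMGF (γ.restrict A) f θ), θ, _,
    Measurable.indicator (by fun_prop) hA, Set.indicator_le_self _ _, ?_⟩
  rw [withDensity_indicator_eexp_sub_logMGF hA hint]
  exact ⟨isProbabilityMeasure_tilted hint, integrable_tilted_of_norm_le hf hM _, hrU hmem, hθ⟩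

lemma meanLaw_withDensity_le [IsProbabilityMeasure γ] (hf : Measurable f) {h : W → ℝ≥0∞}
    (hh : Measurable h) [IsProbabilityMeasure (γ.withDensity h)] {θ : E} {a b : ℝ}
    (hle : ∀ w, h w ≤ eexp (⟪θ, f w⟫ - b)) {B : Set E} (hB : MeasurableSet B)
    (hBa : ∀ x ∈ B, ⟪θ, x⟫ - b ≤ a) (n : ℕ) :
    meanLaw (γ.withDensity h) f n B ≤ eexp (n * a) * meanLaw γ f n B := by
  rw [meanLaw_apply hf n hB, meanLaw_apply hf n hB, pi_withDensity fun _ => hh,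
    withDensity_apply _ (measurable_sampleMean hf n hB), ← setLIntegral_const]
  refine setLIntegral_mono' (measurable_sampleMean hf n hB) fun z hz => ?_
  calc ∏ i, h (z i) ≤ ∏ i, eexp (⟪θ, f (z i)⟫ - b) := Finset.prod_le_prod' fun i _ => hle _
    _ = eexp (n * (⟪θ, sampleMean f z⟫ - b)) := by
        rw [← eexp_sum, Finset.sum_sub_distrib, ← inner_sum, sum_eq_natCast_smul_sampleMean,
          real_inner_smul_right, Finset.sum_const, Finset.card_univ, Fintype.card_fin,
          nsmul_eq_mul, mul_sub]
    _ ≤ eexp (n * a) := by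
        gcongr
        exact hBa _ hz

theorem eventually_eexp_neg_le_meanLaw [IsProbabilityMeasure γ] (hf : Measurable f) {y : E}
    {c : ℝ} (hc : cramerRate γ f y < c) {U : Set E} (hU : U ∈ 𝓝 y) :
    ∀ᶠ n : ℕ in atTop, eexp (-(n * c)) ≤ meanLaw γ f n U := by
  obtain ⟨c₁, hc₁, hc₁c⟩ := EReal.lt_iff_exists_real_btwn.1 hc
  obtain ⟨c₂, hc₁₂, hc₂c⟩ := exists_between (EReal.coe_lt_coe_iff.1 hc₁c)
  obtain ⟨h, θ, b, hh, hle, _, hint, hmU, hθm⟩ :=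
    exists_withDensity_mean_mem hf hc₁ (interior_mem_nhds.2 hU)
  set m := ∫ w, f w ∂(γ.withDensity h)
  have hnhds : interior U ∩ {x | ⟪θ, x⟫ - b < c₂} ∈ 𝓝 m :=
    (isOpen_interior.inter (isOpen_lt (by fun_prop) continuous_const)).mem_nhds
      ⟨hmU, hθm.trans_lt hc₁₂⟩
  obtain ⟨s, hs, hsU⟩ := Metric.mem_nhds_iff.1 hnhds
  filter_upwards [eventually_half_le_meanLaw_ball hf hint hs,
    eventually_mul_eexp_neg_le (m := 2) ENNReal.ofNat_ne_top hc₂c] with n hhalf hexp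
  have htilt : 1 / 2 ≤ eexp (n * c₂) * meanLaw γ f n (Metric.ball m s) :=
    hhalf.trans (meanLaw_withDensity_le hf hh hle measurableSet_ball
      (fun x hx => (hsU hx).2.le) n)
  calc eexp (-(n * c)) = 2 * eexp (-(n * c)) * (1 / 2) := by
        rw [mul_right_comm, one_div, ENNReal.mul_inv_cancel two_ne_zero ENNReal.ofNat_ne_top,
          one_mul]
    _ ≤ eexp (-(n * c₂)) * (eexp (n * c₂) * meanLaw γ f n (Metric.ball m s)) := by gcongr
    _ = meanLaw γ f n (Metric.ball m s) := by
        rw [← mul_assoc, ← eexp_add, neg_add_cancel, eexp_zero, one_mul]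
    _ ≤ meanLaw γ f n U := measure_mono fun x hx => interior_subset (hsU hx).1

end CramerLowerBound

section ControlledFamilies

open scoped RealInnerProductSpace

section MeanLawBounds

variable {W : Type*} [MeasurableSpace W] {γ : Measure W} {E : Type*} [NormedAddCommGroup E]
  [InnerProductSpace ℝ E] [MeasurableSpace E] [BorelSpace E] [SecondCountableTopology E]
  {f g : W → E} {q : W → ℝ}

lemma meanLaw_setOf_le_inner_le [IsProbabilityMeasure γ] (hf : Measurable f) {θ : E} {b : ℝ}
    (hb : ∫⁻ w, eexp ⟪θ, f w⟫ ∂γ ≤ eexp b) (n : ℕ) (a : ℝ) :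
    meanLaw γ f n {y | a + b ≤ ⟪θ, y⟫} ≤ eexp (-(n * a)) := by
  have h := measure_pi_mul_le_sum_le (φ := fun w => ⟪θ, f w⟫) (by fun_prop) hb n (a + b)
  rw [add_sub_cancel_right] at h
  rw [meanLaw_apply hf n (measurableSet_le measurable_const (by fun_prop))]
  refine (measure_mono fun z hz => ?_).trans h
  rw [Set.mem_preimage, Set.mem_ofPred_eq] at hz
  rw [Set.mem_ofPred_eq, ← inner_sum, sum_eq_natCast_smul_sampleMean, real_inner_smul_right]
  gcongr

lemma meanLaw_ball_le_add (hf : Measurable f) (hg : Measurable g) {ε r : ℝ} (hε : 0 < ε)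
    (hfg : ∀ w, ‖g w - f w‖ ≤ ε * q w) (y : E) (n : ℕ) :
    meanLaw γ f n (Metric.ball y r) ≤ meanLaw γ g n (Metric.ball y (r + r)) +
      (Measure.pi fun _ : Fin n => γ) {z | n * (r / ε) ≤ ∑ i, q (z i)} := by
  rw [meanLaw_apply hf n measurableSet_ball, meanLaw_apply hg n measurableSet_ball]
  refine (measure_mono fun z hz => ?_).trans (measure_union_le _ _)
  refine or_iff_not_imp_right.2 fun hsum => ?_
  rw [Set.mem_ofPred_eq, not_le, ← mul_div_assoc, lt_div_iff₀' hε] at hsum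
  have hdist : n * ‖sampleMean g z - sampleMean f z‖ < n * r := by
    rw [← sampleMean_sub]
    refine (natCast_mul_norm_sampleMean_le hfg z).trans_lt ?_
    rwa [← Finset.mul_sum]
  refine (dist_triangle _ (sampleMean f z) _).trans_lt (add_lt_add ?_ hz)
  rw [dist_eq_norm]
  exact lt_of_mul_lt_mul_left hdist n.cast_nonneg

end MeanLawBounds

variable {W : Type*} [MeasurableSpace W] {γ : Measure W}
  {𝕏 : Type*} [TopologicalSpace 𝕏] {E : Type*} [NormedAddCommGroup E] [MeasurableSpace E]

/-- A family `F` of integrands depending on a parameter in `𝕏` that is dominated by a control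
function `q` with an exponential moment, and depends on the parameter continuously in the weighted
sup norm `sup ‖f‖ / q`. -/
structure IsControlledFamily (γ : Measure W) (F : 𝕏 → W → E) (q : W → ℝ) : Prop where
  measurable : ∀ x, Measurable (F x)
  measurable_control : Measurable q
  exists_lintegral_ne_top : ∃ t : ℝ, 0 < t ∧ ∫⁻ w, eexp (t * q w) ∂γ ≠ ∞
  eventually_norm_sub_le : ∀ x (ε : ℝ), 0 < ε → ∀ᶠ x' in 𝓝 x, ∀ w, ‖F x' w - F x w‖ ≤ ε * q w
  exists_norm_le : ∀ x, ∃ A : ℝ, ∀ w, ‖F x w‖ ≤ A * q w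

namespace IsControlledFamily

variable {F : 𝕏 → W → E} {q : W → ℝ}

lemma control_nonneg (hF : IsControlledFamily γ F q) (x : 𝕏) (w : W) : 0 ≤ q w := by
  have h := (hF.eventually_norm_sub_le x 1 one_pos).self_of_nhds w
  rwa [sub_self, norm_zero, one_mul] at h

lemma exists_lintegral_le (hF : IsControlledFamily γ F q) :
    ∃ t B : ℝ, 0 < t ∧ ∫⁻ w, eexp (t * q w) ∂γ ≤ eexp B := by
  obtain ⟨t, ht, htop⟩ := hF.exists_lintegral_ne_top
  obtain ⟨B, hB⟩ := exists_le_eexp htop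
  exact ⟨t, B, ht, hB⟩

lemma exists_forall_norm_le_of_isCompact (hF : IsControlledFamily γ F q) {K : Set 𝕏}
    (hK : IsCompact K) : ∃ A : ℝ, 0 < A ∧ ∀ x ∈ K, ∀ w, ‖F x w‖ ≤ A * q w := by
  refine hK.induction_on (p := fun K => ∃ A : ℝ, 0 < A ∧ ∀ x ∈ K, ∀ w, ‖F x w‖ ≤ A * q w)
    ⟨1, one_pos, by simp⟩ ?_ ?_ fun x _ => ?_
  · rintro s t hst ⟨A, hA, ht⟩
    exact ⟨A, hA, fun x hx => ht x (hst hx)⟩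
  · rintro s t ⟨A, hA, hs⟩ ⟨A', -, ht⟩
    refine ⟨max A A', lt_max_of_lt_left hA, fun x hx w => ?_⟩
    have hq := hF.control_nonneg x w
    rcases hx with hx | hx
    · exact (hs x hx w).trans (by gcongr; exact le_max_left _ _)
    · exact (ht x hx w).trans (by gcongr; exact le_max_right _ _)
  · obtain ⟨A, hA⟩ := hF.exists_norm_le x
    refine ⟨_, mem_nhdsWithin_of_mem_nhds (hF.eventually_norm_sub_le x 1 one_pos), |A| + 1,
      by positivity, fun x' (hx' : ∀ _, _) w => ?_⟩
    have hq := hF.control_nonneg x w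
    calc ‖F x' w‖ ≤ ‖F x w‖ + ‖F x' w - F x w‖ := norm_le_norm_add_norm_sub' _ _
      _ ≤ A * q w + 1 * q w := add_le_add (hA w) (hx' w)
      _ ≤ (|A| + 1) * q w := by
          rw [← add_mul]
          gcongr
          exact le_abs_self A

variable [BorelSpace E] [InnerProductSpace ℝ E] [FiniteDimensional ℝ E]

/-- Hölder's inequality splits off the deviation of `F x'` from `F x`, which near `x` is
absorbed by the exponential moment of the control. -/
lemma eventually_lintegral_eexp_inner_le (hF : IsControlledFamily γ F q) {x : 𝕏} {y θ : E}
    {a a' : ℝ} (ha : a < a') (hθ : ∫⁻ w, eexp ⟪θ, F x w⟫ ∂γ ≤ eexp (⟪θ, y⟫ - a')) :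
    ∃ (θ' : E) (b : ℝ), a + b < ⟪θ', y⟫ ∧
      ∀ᶠ x' in 𝓝 x, ∫⁻ w, eexp ⟪θ', F x' w⟫ ∂γ ≤ eexp b := by
  obtain ⟨t, B, ht, hB⟩ := hF.exists_lintegral_le
  obtain ⟨s, hs, hs0, hs1⟩ : ∃ s : ℝ, a + (1 - s) * B < s * a' ∧ 0 < s ∧ s < 1 := by
    have hlim : ∀ᶠ s : ℝ in 𝓝 1, a + (1 - s) * B < s * a' :=
      ContinuousAt.eventually_lt (by fun_prop) (by fun_prop) (by simpa using ha)
    exact ((hlim.filter_mono nhdsWithin_le_nhds).and (Ioo_mem_nhdsLT one_pos)).exists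
  refine ⟨s • θ, s * (⟪θ, y⟫ - a') + (1 - s) * B, ?_, ?_⟩
  · rw [real_inner_smul_left]
    linarith
  have hs1' : 0 < 1 - s := sub_pos.2 hs1
  filter_upwards [hF.eventually_norm_sub_le x ((1 - s) * t / (‖θ‖ + 1)) (by positivity)] with x' hx'
  have hinner (w : W) : ⟪s • θ, F x' w⟫ ≤ s * ⟪θ, F x w⟫ + (1 - s) * (t * q w) := by
    have hdiff : s * ⟪θ, F x' w - F x w⟫ ≤ (1 - s) * (t * q w) :=
      calc s * ⟪θ, F x' w - F x w⟫ ≤ s * (‖θ‖ * ‖F x' w - F x w‖) := by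
            gcongr
            exact real_inner_le_norm _ _
        _ ≤ 1 * ((‖θ‖ + 1) * ((1 - s) * t / (‖θ‖ + 1) * q w)) := by
            gcongr
            · exact (lt_add_one _).le
            · exact hx' w
        _ = (1 - s) * (t * q w) := by field_simp
    rw [inner_sub_right] at hdiff
    rw [real_inner_smul_left]
    linarith
  have hmeas : Measurable fun w => ⟪θ, F x w⟫ := Measurable.const_inner (𝕜 := ℝ) (hF.measurable x)
  have hq := hF.measurable_control
  calc ∫⁻ w, eexp ⟪s • θ, F x' w⟫ ∂γ
      ≤ ∫⁻ w, eexp (s * ⟪θ, F x w⟫ + (1 - s) * (t * q w)) ∂γ :=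
        lintegral_mono fun w => eexp_mono (hinner w)
    _ ≤ (∫⁻ w, eexp ⟪θ, F x w⟫ ∂γ) ^ s * (∫⁻ w, eexp (t * q w) ∂γ) ^ (1 - s) :=
        lintegral_eexp_add_le (by fun_prop) (by fun_prop) hs0.le hs1.le
    _ ≤ eexp (⟪θ, y⟫ - a') ^ s * eexp B ^ (1 - s) := by gcongr
    _ = eexp (s * (⟪θ, y⟫ - a') + (1 - s) * B) := by
        rw [← eexp_mul, ← eexp_mul, ← eexp_add, mul_comm s, mul_comm (1 - s)]

variable [IsProbabilityMeasure γ]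

lemma eventually_eexp_neg_le_meanLaw (hF : IsControlledFamily γ F q) {x : 𝕏} {y : E} {a : ℝ}
    (ha : cramerRate γ (F x) y < a) {V : Set E} (hV : V ∈ 𝓝 y) :
    ∃ U ∈ 𝓝 x, ∀ᶠ n : ℕ in atTop, ∀ x' ∈ U, eexp (-(n * a)) ≤ meanLaw γ (F x') n V := by
  obtain ⟨c, hc, hca⟩ := EReal.lt_iff_exists_real_btwn.1 ha
  obtain ⟨r, hr, hrV⟩ := Metric.mem_nhds_iff.1 hV
  obtain ⟨t, B, ht, hB⟩ := hF.exists_lintegral_le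
  set ε : ℝ := r / 2 / ((|a + B| + 1) / t)
  have hε : 0 < ε := by positivity
  refine ⟨_, hF.eventually_norm_sub_le x ε hε, ?_⟩
  filter_upwards [CovLDP.eventually_eexp_neg_le_meanLaw (hF.measurable x) hc
    (Metric.ball_mem_nhds y (half_pos hr)),
    eventually_mul_eexp_neg_le (m := 2) ENNReal.ofNat_ne_top (EReal.coe_lt_coe_iff.1 hca)]
    with n hlow hexp x' hx'
  have htail : (Measure.pi fun _ : Fin n => γ) {z | n * (r / 2 / ε) ≤ ∑ i, q (z i)} ≤
      eexp (-(n * a)) := by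
    refine (measure_mono fun z hz => ?_).trans
      (measure_pi_mul_le_sum_le_of_lintegral_le hF.measurable_control ht hB n a)
    rw [Set.mem_ofPred_eq] at hz ⊢
    refine le_trans ?_ hz
    rw [div_div_cancel₀ (half_pos hr).ne']
    have habs : a + B ≤ |a + B| + 1 := (le_abs_self _).trans (lt_add_one _).le
    gcongr
  refine (ENNReal.add_le_add_iff_right (eexp_ne_top (-(n * a)))).1 ?_
  calc eexp (-(n * a)) + eexp (-(n * a)) = 2 * eexp (-(n * a)) := (two_mul _).symm
    _ ≤ meanLaw γ (F x) n (Metric.ball y (r / 2)) := hexp.trans hlow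
    _ ≤ meanLaw γ (F x') n (Metric.ball y (r / 2 + r / 2)) + _ :=
        meanLaw_ball_le_add (hF.measurable x) (hF.measurable x') hε hx' y n
    _ ≤ meanLaw γ (F x') n V + eexp (-(n * a)) := by
        rw [add_halves]
        gcongr

lemma eventually_meanLaw_le_eexp_neg (hF : IsControlledFamily γ F q) {x : 𝕏} {y : E} {a : ℝ}
    (ha : a < cramerRate γ (F x) y) :
    ∃ U ∈ 𝓝 x, ∃ V ∈ 𝓝 y, ∀ᶠ n : ℕ in atTop, ∀ x' ∈ U,
      meanLaw γ (F x') n V ≤ eexp (-(n * a)) := by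
  obtain ⟨a', haa', ha'⟩ := EReal.lt_iff_exists_real_btwn.1 ha
  obtain ⟨θ, hθ⟩ := coe_lt_cramerRate.1 ha'
  obtain ⟨θ', b, hb, hU⟩ :=
    hF.eventually_lintegral_eexp_inner_le (EReal.coe_lt_coe_iff.1 haa') hθ.le
  have hV : ∀ᶠ y' in 𝓝 y, a + b ≤ ⟪θ', y'⟫ :=
    (ContinuousAt.eventually_lt (by fun_prop) (by fun_prop) hb).mono fun _ => le_of_lt
  exact ⟨_, hU, _, hV, Eventually.of_forall fun n x' hx' =>
    meanLaw_setOf_le_inner_le (hF.measurable x') hx' n a⟩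

lemma exists_isCompact_meanLaw_compl_le (hF : IsControlledFamily γ F q) {K : Set 𝕏}
    (hK : IsCompact K) (a : ℝ) :
    ∃ K' : Set E, IsCompact K' ∧ ∀ n : ℕ, ∀ x ∈ K, meanLaw γ (F x) n K'ᶜ ≤ eexp (-(n * a)) := by
  obtain ⟨t, B, ht, hB⟩ := hF.exists_lintegral_le
  obtain ⟨A, hA, hle⟩ := hF.exists_forall_norm_le_of_isCompact hK
  refine ⟨Metric.closedBall 0 (A * ((a + B) / t)), isCompact_closedBall _ _, fun n x hx => ?_⟩
  rw [meanLaw_apply (hF.measurable x) n measurableSet_closedBall.compl]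
  refine (measure_mono fun z hz => ?_).trans
    (measure_pi_mul_le_sum_le_of_lintegral_le hF.measurable_control ht hB n a)
  rw [Set.mem_preimage, Set.mem_compl_iff, mem_closedBall_zero_iff, not_le] at hz
  refine le_of_mul_le_mul_left ?_ hA
  calc A * (n * ((a + B) / t)) = n * (A * ((a + B) / t)) := mul_left_comm _ _ _
    _ ≤ n * ‖sampleMean (F x) z‖ := by gcongr
    _ ≤ ∑ i, A * q (z i) := natCast_mul_norm_sampleMean_le (hle x hx) z
    _ = A * ∑ i, q (z i) := (Finset.mul_sum _ _ _).symm

theorem satisfiesLocallyUniformLDP (hF : IsControlledFamily γ F q) :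
    SatisfiesLocallyUniformLDP (fun n x => meanLaw γ (F x) n) fun x => cramerRate γ (F x) where
  ne_bot _ _ := (EReal.bot_lt_zero.trans_le cramerRate_nonneg).ne'
  lower _ _ _ ha _ hV := hF.eventually_eexp_neg_le_meanLaw ha hV
  upper _ _ _ ha := hF.eventually_meanLaw_le_eexp_neg ha
  tight _ hK a := by
    obtain ⟨K', hK', h⟩ := hF.exists_isCompact_meanLaw_compl_le hK a
    exact ⟨K', hK', Eventually.of_forall h⟩

end IsControlledFamily

end ControlledFamilies

section QuadraticIncrements

variable {U V E : Type*} [NormedAddCommGroup U] [NormedSpace ℝ U] [NormedAddCommGroup V]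
  [NormedSpace ℝ V] [NormedAddCommGroup E] {f : V → E}

/-- The increment condition of `QuadraticIncrement` for maps between normed spaces. -/
def HasQuadraticIncrement (f : V → E) : Prop :=
  ∀ ε : ℝ, 0 < ε → ∃ C : ℝ, 0 < C ∧ ∀ z z' : V,
    ‖f z - f z'‖ ≤ C * (1 + ‖z - z'‖ * (‖z‖ + ‖z'‖)) + ε * (‖z‖ ^ 2 + ‖z'‖ ^ 2)

namespace HasQuadraticIncrement

lemma exists_norm_comp_le (hf : HasQuadraticIncrement f) (T : U →L[ℝ] V) :
    ∃ A : ℝ, ∀ z, ‖f (T z)‖ ≤ A * (1 + ‖z‖ ^ 2) := by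
  obtain ⟨C, hC, hinc⟩ := hf 1 one_pos
  refine ⟨‖f 0‖ + C * (1 + ‖T‖ ^ 2) + ‖T‖ ^ 2, fun z => ?_⟩
  have hTz : ‖T z‖ ^ 2 ≤ ‖T‖ ^ 2 * ‖z‖ ^ 2 := by
    rw [← mul_pow]
    gcongr
    exact T.le_opNorm z
  calc ‖f (T z)‖ ≤ ‖f 0‖ + ‖f (T z) - f 0‖ := norm_le_norm_add_norm_sub' _ _
    _ ≤ ‖f 0‖ + (C * (1 + ‖T z‖ ^ 2) + ‖T z‖ ^ 2) := by
        gcongr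
        simpa [pow_two] using hinc (T z) 0
    _ ≤ ‖f 0‖ + (C * (1 + ‖T‖ ^ 2 * ‖z‖ ^ 2) + ‖T‖ ^ 2 * ‖z‖ ^ 2) := by gcongr
    _ ≤ ‖f 0‖ + (C * (1 + ‖T‖ ^ 2 * ‖z‖ ^ 2) + ‖T‖ ^ 2 * ‖z‖ ^ 2) +
          (‖f 0‖ * ‖z‖ ^ 2 + C * ‖T‖ ^ 2 + C * ‖z‖ ^ 2 + ‖T‖ ^ 2) :=
        le_add_of_nonneg_right (by positivity)
    _ = (‖f 0‖ + C * (1 + ‖T‖ ^ 2) + ‖T‖ ^ 2) * (1 + ‖z‖ ^ 2) := by ring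

lemma exists_eventually_norm_comp_sub_le (hf : HasQuadraticIncrement f) (T : U →L[ℝ] V) {ε : ℝ}
    (hε : 0 < ε) :
    ∃ R : ℝ, ∀ᶠ T' in 𝓝 T, ∀ z : U, R ≤ ‖z‖ → ‖f (T' z) - f (T z)‖ ≤ ε * ‖z‖ ^ 2 := by
  set B : ℝ := ‖T‖ + 1
  have hB : 0 < B := by positivity
  obtain ⟨C, hC, hinc⟩ := hf (ε / (6 * B ^ 2)) (by positivity)
  refine ⟨√(3 * C / ε), ?_⟩
  filter_upwards [Metric.ball_mem_nhds T one_pos,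
    Metric.ball_mem_nhds T (show 0 < ε / (6 * B * C) by positivity)] with T' hT'1 hT' z hz
  rw [mem_ball_iff_norm] at hT'1 hT'
  have hCz : C ≤ ε / 3 * ‖z‖ ^ 2 := by
    rw [Real.sqrt_le_left (norm_nonneg z), div_le_iff₀ hε] at hz
    linarith
  have hnorm : ‖T'‖ ≤ B := by
    linarith [norm_le_norm_add_norm_sub' T' T]
  have hT'z : ‖T' z‖ ≤ B * ‖z‖ := T'.le_of_opNorm_le hnorm z
  have hTz : ‖T z‖ ≤ B * ‖z‖ := T.le_of_opNorm_le (lt_add_one _).le z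
  have hsub : ‖T' z - T z‖ ≤ ε / (6 * B * C) * ‖z‖ := (T' - T).le_of_opNorm_le hT'.le z
  calc ‖f (T' z) - f (T z)‖
      ≤ C * (1 + ‖T' z - T z‖ * (‖T' z‖ + ‖T z‖)) +
          ε / (6 * B ^ 2) * (‖T' z‖ ^ 2 + ‖T z‖ ^ 2) := hinc _ _
    _ ≤ C * (1 + ε / (6 * B * C) * ‖z‖ * (B * ‖z‖ + B * ‖z‖)) +
          ε / (6 * B ^ 2) * ((B * ‖z‖) ^ 2 + (B * ‖z‖) ^ 2) := by gcongr
    _ = C + 2 * (ε / 3 * ‖z‖ ^ 2) := by field_simp; ring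
    _ ≤ ε * ‖z‖ ^ 2 := by linarith

/-- On large balls the increment condition gives the bound, on the remaining compact ball
continuity does. -/
lemma eventually_norm_comp_sub_le [ProperSpace U] (hf : HasQuadraticIncrement f)
    (hcont : Continuous f) (T : U →L[ℝ] V) {ε : ℝ} (hε : 0 < ε) :
    ∀ᶠ T' in 𝓝 T, ∀ z : U, ‖f (T' z) - f (T z)‖ ≤ ε * (1 + ‖z‖ ^ 2) := by
  obtain ⟨R, hlarge⟩ := hf.exists_eventually_norm_comp_sub_le T hε
  have hsmall : ∀ᶠ T' in 𝓝 T, ∀ z ∈ Metric.closedBall (0 : U) R, ‖f (T' z) - f (T z)‖ < ε := by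
    refine (isCompact_closedBall 0 R).eventually_forall_of_forall_eventually fun z _ => ?_
    have hc : Continuous fun p : (U →L[ℝ] V) × U => ‖f (p.1 p.2) - f (T p.2)‖ := by fun_prop
    exact hc.continuousAt.eventually_lt_const (by simpa using hε)
  filter_upwards [hlarge, hsmall] with T' hlarge hsmall z
  rcases le_total R ‖z‖ with hz | hz
  · exact (hlarge z hz).trans (by gcongr; exact le_add_of_nonneg_left zero_le_one)
  · exact (hsmall z (mem_closedBall_zero_iff.2 hz)).le.trans
      (le_mul_of_one_le_right hε.le (le_add_of_nonneg_right (by positivity)))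

end HasQuadraticIncrement

lemma exists_lintegral_eexp_sq_ne_top [CompleteSpace U] [SecondCountableTopology U]
    [MeasurableSpace U] [BorelSpace U] (γ : Measure U) [IsGaussian γ] :
    ∃ t : ℝ, 0 < t ∧ ∫⁻ z, eexp (t * (1 + ‖z‖ ^ 2)) ∂γ ≠ ∞ := by
  obtain ⟨t, ht, hint⟩ := IsGaussian.exists_integrable_exp_sq γ
  have hint' : Integrable (fun z => Real.exp (t * (1 + ‖z‖ ^ 2))) γ := by
    simp_rw [mul_add, Real.exp_add]
    exact hint.const_mul _
  exact ⟨t, ht, hint'.lintegral_lt_top.ne⟩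

theorem HasQuadraticIncrement.isControlledFamily [FiniteDimensional ℝ U] [MeasurableSpace U]
    [BorelSpace U] [MeasurableSpace E] [BorelSpace E] (hf : HasQuadraticIncrement f)
    (hcont : Continuous f) (γ : Measure U) [IsGaussian γ] :
    IsControlledFamily γ (fun (T : U →L[ℝ] V) z => f (T z)) fun z => 1 + ‖z‖ ^ 2 where
  measurable T := (hcont.comp T.continuous).measurable
  measurable_control := by fun_prop
  exists_lintegral_ne_top :=
    have := FiniteDimensional.complete ℝ U
    exists_lintegral_eexp_sq_ne_top γ
  eventually_norm_sub_le T _ hε :=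
    have := FiniteDimensional.proper ℝ U
    hf.eventually_norm_comp_sub_le hcont T hε
  exists_norm_le := hf.exists_norm_comp_le

end QuadraticIncrements

section Matrices

open scoped RealInnerProductSpace MatrixOrder Matrix.Norms.L2Operator

variable {d : ℕ}

/-- The entries of a matrix as a Euclidean vector, so that the Euclidean norm becomes the
Frobenius norm and the inner product becomes `tr(Aᵀ B)`. -/
def matVec : Matrix (Fin d) (Fin d) ℝ ≃ₗ[ℝ] EuclideanSpace ℝ (Fin d × Fin d) :=
  (LinearEquiv.curry ℝ ℝ (Fin d) (Fin d)).symm.trans (WithLp.linearEquiv 2 ℝ _).symm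

lemma inner_matVec (A B : Matrix (Fin d) (Fin d) ℝ) :
    ⟪matVec A, matVec B⟫ = (A.transpose * B).trace := by
  have happly (A : Matrix (Fin d) (Fin d) ℝ) (p : Fin d × Fin d) : matVec A p = A p.1 p.2 := rfl
  simp only [PiLp.inner_apply, happly, Matrix.trace, Matrix.diag_apply, Matrix.mul_apply,
    Matrix.transpose_apply, Fintype.sum_prod_type_right, RCLike.inner_apply', conj_trivial]

lemma norm_matVec (A : Matrix (Fin d) (Fin d) ℝ) : ‖matVec A‖ = frobNorm A := by
  rw [frobNorm, ← inner_matVec, real_inner_self_eq_norm_sq, Real.sqrt_sq (norm_nonneg _)]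

lemma isClosed_setOf_posSemidef : IsClosed {A : Matrix (Fin d) (Fin d) ℝ | A.PosSemidef} := by
  simp only [Matrix.posSemidef_iff_dotProduct_mulVec, Set.ofPred_and, Set.ofPred_forall,
    Matrix.IsHermitian]
  refine IsClosed.inter (isClosed_eq (by fun_prop) (by fun_prop))
    (isClosed_iInter fun v => isClosed_le continuous_const ?_)
  fun_prop

lemma isClosedEmbedding_matVec : IsClosedEmbedding fun Q : PSD d => matVec Q.1 :=
  matVec.toContinuousLinearEquiv.toHomeomorph.isClosedEmbedding.comp
    isClosed_setOf_posSemidef.isClosedEmbedding_subtypeVal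

lemma inner_matVec_symmPart (A : Matrix (Fin d) (Fin d) ℝ) (Q : PSD d) :
    ⟪matVec ((2⁻¹ : ℝ) • (A + A.transpose)), matVec Q.1⟫ = ⟪matVec A, matVec Q.1⟫ := by
  have hQ : Q.1.transpose = Q.1 := (Matrix.conjTranspose_eq_transpose_of_trivial _).symm.trans Q.2.1
  have htranspose : ⟪matVec A.transpose, matVec Q.1⟫ = ⟪matVec A, matVec Q.1⟫ := by
    rw [inner_matVec, inner_matVec, Matrix.transpose_transpose, ← Matrix.trace_transpose,
      Matrix.transpose_mul, hQ, Matrix.trace_mul_comm]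
  rw [map_smul, map_add, real_inner_smul_left, inner_add_left, htranspose, ← two_mul,
    inv_mul_cancel_left₀ two_ne_zero]

lemma isSymm_symmPart (A : Matrix (Fin d) (Fin d) ℝ) :
    ((2⁻¹ : ℝ) • (A + A.transpose)).IsSymm := by
  simpa [Matrix.IsSymm] using add_comm _ _

/-- The operator `√Q` on Euclidean space. -/
def sqrtOp (Q : PSD d) : Vec d →L[ℝ] Vec d :=
  Matrix.toEuclideanCLM (𝕜 := ℝ) (CFC.sqrt Q.1)

lemma continuous_sqrtOp : Continuous (sqrtOp (d := d)) := by
  have hsqrt : Continuous fun Q : PSD d => CFC.sqrt Q.1 :=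
    CFC.continuousOn_sqrt.comp_continuous continuous_subtype_val fun Q =>
      Matrix.nonneg_iff_posSemidef.2 Q.2
  have hclm : Continuous (Matrix.toEuclideanCLM (n := Fin d) (𝕜 := ℝ)) :=
    LinearMap.continuous_of_finiteDimensional
      (Matrix.toEuclideanCLM (n := Fin d) (𝕜 := ℝ)).toAlgEquiv.toLinearMap
  exact hclm.comp hsqrt

lemma multivariateGaussian_zero_eq_map (Q : PSD d) :
    multivariateGaussian 0 Q.1 = (stdGaussian (Vec d)).map (sqrtOp Q) := by
  simp only [multivariateGaussian, zero_add]
  rfl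

end Matrices

section TransitionKernels

open scoped RealInnerProductSpace

variable {d d' : ℕ} {g : Vec d → PSD d'}

lemma QuadraticIncrement.hasQuadraticIncrement (hg : QuadraticIncrement g) :
    HasQuadraticIncrement fun z => matVec (g z).1 := by
  simpa only [HasQuadraticIncrement, ← map_sub, norm_matVec] using hg.2

lemma expMoment_eq_lintegral (hg : Continuous g) (Q : PSD d) (A : Matrix (Fin d') (Fin d') ℝ) :
    expMoment g Q A =
      ∫⁻ z, eexp ⟪matVec A, matVec (g (sqrtOp Q z)).1⟫ ∂(stdGaussian (Vec d)) := by
  have hmeas : Measurable fun z => eexp ⟪matVec A, matVec (g z).1⟫ :=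
    (continuous_eexp.comp
      (continuous_const.inner (isClosedEmbedding_matVec.continuous.comp hg))).measurable
  rw [← lintegral_map hmeas (sqrtOp Q).continuous.measurable, ← multivariateGaussian_zero_eq_map]
  simp only [expMoment, inner_matVec, eexp]

lemma condRate_eq_cramerRate (hg : Continuous g) (Q : PSD d) (Q' : PSD d') :
    condRate g Q Q' =
      cramerRate (stdGaussian (Vec d)) (fun z => matVec (g (sqrtOp Q z)).1) (matVec Q'.1) := by
  simp only [condRate, cramerRate, expMoment_eq_lintegral hg, ← inner_matVec]
  refine le_antisymm (iSup_le fun A => le_iSup_of_le (matVec A.1) le_rfl) (iSup_le fun θ => ?_)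
  obtain ⟨A, rfl⟩ := matVec.surjective θ
  refine le_iSup_of_le ⟨_, isSymm_symmPart A⟩ (le_of_eq ?_)
  simp only [inner_matVec_symmPart]

lemma matVec_empMean {W : Type*} (f : W → PSD d) {n : ℕ} (z : Fin n → W) :
    matVec (empMean fun i => f (z i)).1 = sampleMean (fun w => matVec (f w).1) z := by
  simp only [empMean, sampleMean, map_smul, map_sum]

lemma map_matVec_transition (hg : Continuous g) (n : ℕ) (Q : PSD d) :
    (transition g n Q).map (fun A => matVec A.1) =
      meanLaw (stdGaussian (Vec d)) (fun z => matVec (g (sqrtOp Q z)).1) n := by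
  have hmean : Measurable fun Z : Fin n → Vec d => empMean fun i => g (sqrtMul Q (Z i)) := by
    refine (Continuous.subtype_mk ?_ _).measurable
    have hterm (i : Fin n) : Continuous fun Z : Fin n → Vec d => (g (sqrtMul Q (Z i))).1 :=
      continuous_subtype_val.comp (hg.comp ((sqrtOp Q).continuous.comp (continuous_apply i)))
    exact (continuous_finsetSum _ fun i _ => hterm i).const_smul ((n : ℝ)⁻¹)
  rw [transition, Measure.map_map isClosedEmbedding_matVec.continuous.measurable hmean]
  exact congrArg (Measure.map · _) (funext fun Z => matVec_empMean (fun z => g (sqrtMul Q z)) Z)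

theorem QuadraticIncrement.satisfiesLocallyUniformLDP_transition (hg : QuadraticIncrement g) :
    SatisfiesLocallyUniformLDP (fun n => transition g n) (condRate g) := by
  have hcont : Continuous fun z => matVec (g z).1 := isClosedEmbedding_matVec.continuous.comp hg.1
  have h := (hg.hasQuadraticIncrement.isControlledFamily hcont
    (stdGaussian (Vec d))).satisfiesLocallyUniformLDP.comp_continuous continuous_sqrtOp
  simp only [← map_matVec_transition hg.1] at h
  simpa only [← condRate_eq_cramerRate hg.1] using
    h.of_map_isClosedEmbedding isClosedEmbedding_matVec

end TransitionKernels

section Chain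

lemma isClosedEmbedding_finCons {L : ℕ} {S : Fin (L + 1) → Type*} [∀ i, TopologicalSpace (S i)]
    [∀ i, T2Space (S i)] (x₀ : S 0) :
    IsClosedEmbedding (Fin.cons x₀ : ((ℓ : Fin L) → S ℓ.succ) → (i : Fin (L + 1)) → S i) :=
  Function.LeftInverse.isClosedEmbedding (Fin.tail_cons (α := S) x₀) (by fun_prop) (by fun_prop)

variable {Ω : Type*} [MeasurableSpace Ω] {P : Measure Ω} {L : ℕ}
  {D : Fin (L + 1) → ℕ} {G : (ℓ : Fin L) → Vec (D ℓ.castSucc) → PSD (D ℓ.succ)}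

namespace IsCovChain

variable {C : Fin L → ℕ} {Q₀ : PSD (D 0)} {X : (i : Fin (L + 1)) → Ω → PSD (D i)}

lemma map_finCons (h : IsCovChain P G C Q₀ X) :
    (P.map fun ω (ℓ : Fin L) => X ℓ.succ ω).map
        (Fin.cons (α := fun i => PSD (D i)) Q₀) = P.map fun ω i => X i ω := by
  rw [Measure.map_map
    (isClosedEmbedding_finCons (S := fun i => PSD (D i)) Q₀).continuous.measurable
    (measurable_pi_lambda _ fun ℓ => h.measurable ℓ.succ)]
  refine Measure.map_congr ?_
  filter_upwards [h.init] with ω hω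
  rw [Function.comp_apply, ← hω]
  exact Fin.cons_self_tail fun i => X i ω

variable [IsProbabilityMeasure P]

lemma isMarkovSequence (h : IsCovChain P G C Q₀ X) :
    IsMarkovSequence P (fun ℓ => transition (G ℓ) (C ℓ)) X where
  measurable := h.measurable
  isTransition ℓ := by
    have hX : Measurable fun ω (i : {i : Fin (L + 1) // i ≤ ℓ.castSucc}) => X i ω :=
      measurable_pi_lambda _ fun i => h.measurable i
    have (Q : PSD (D ℓ.castSucc)) : IsFiniteMeasure (transition (G ℓ) (C ℓ) Q) := by
      unfold transition
      infer_instance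
    refine isTransition_of_condExp hX (h.measurable ℓ.succ) ?_
    simp only [MeasurableSpace.pi, MeasurableSpace.comap_iSup, MeasurableSpace.comap_comp]
    exact h.markov ℓ

lemma map_zero (h : IsCovChain P G C Q₀ X) : P.map (X 0) = Measure.dirac Q₀ := by
  rw [Measure.map_congr h.init, Measure.map_const, measure_univ, one_smul]

end IsCovChain

end Chain

end CovLDP

end

theorem mainTheorem2 {Ω : Type*} [MeasurableSpace Ω] (P : Measure Ω) [IsProbabilityMeasure P]
    (L : ℕ) (D : Fin (L + 1) → ℕ)
    (G : (ℓ : Fin L) → CovLDP.Vec (D ℓ.castSucc) → CovLDP.PSD (D ℓ.succ))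
    (hG : ∀ ℓ, CovLDP.QuadraticIncrement (G ℓ))
    (C : Fin L → ℕ → ℕ) (α : Fin L → ℝ) (hα : ∀ ℓ, 0 < α ℓ)
    (hC : ∀ ℓ, Tendsto (fun n : ℕ => (C ℓ n : ℝ) / (n : ℝ)) atTop (𝓝 (α ℓ)))
    (K₁ : CovLDP.PSD (D 0))
    (K : ℕ → (i : Fin (L + 1)) → Ω → CovLDP.PSD (D i))
    (hK : ∀ n, 1 ≤ n → CovLDP.IsCovChain P G (fun ℓ => C ℓ n) K₁ (K n)) :
    CovLDP.IsGoodRateFunction (CovLDP.chainRate G α K₁) ∧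
      CovLDP.SatisfiesLDP (fun n : ℕ => P.map fun ω (ℓ : Fin L) => K n ℓ.succ ω)
        (CovLDP.chainRate G α K₁) := by
  have hchain := (eventually_ge_atTop 1).mono hK
  have hinit := (CovLDP.satisfiesLocalLDP_dirac K₁).congr
    (hchain.mono fun n hn => hn.map_zero.symm)
  have hlayer (ℓ : Fin L) :=
    (hG ℓ).satisfiesLocallyUniformLDP_transition.comp_speed (hα ℓ) (hC ℓ)
  have hpath := CovLDP.IsMarkovSequence.satisfiesLocalLDP
    (hchain.mono fun n hn => hn.isMarkovSequence) hinit hlayer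
  have htail := (hpath.congr (hchain.mono fun n hn => hn.map_finCons.symm)).of_map_isClosedEmbedding
    (CovLDP.isClosedEmbedding_finCons (S := fun i => CovLDP.PSD (D i)) K₁)
  simp only [Fin.cons_zero, Fin.cons_succ, if_true, zero_add] at htail
  exact ⟨htail.isGoodRateFunction, htail.satisfiesLDP⟩
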